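/- **Theorem.** Let $2\le p<\infty$, $\frac1p+\frac1q=1$, and let $E_1,E_2$ be real Banach spaces that are $p$-uniformly convex (there is $c>0$ with $\delta_E(\varepsilon)>c\,\varepsilon^p$ for all $\varepsilon\in(0,2]$, where $\delta_E(\varepsilon)=\inf\{1-\|x+y\|/2:\|x\|,\|y\|\le1,\ \|x-y\|\ge\varepsilon\}$) and uniformly smooth ($\rho_E(t)/t\to0$ as $t\to0^+$, where $\rho_E(t)=\sup\{\frac12(\|x+y\|+\|x-y\|)-1:\|x\|\le1,\|y\|\le t\}$). For $r>1$ let $J_E^r(x)$ denote the element $x^*\in E^*$ with $\langle x,x^*\rangle=\|x\|^r$, $\|x^*\|=\|x\|^{r-1}$ (it is unique in the spaces concerned); $J_{E_1^*}^q$ is regarded as a map $E_1^*\to E_1$ by reflexivity. Let $$\Delta_p(x,y)=\tfrac1p\|y\|^p-\tfrac1p\|x\|^p-\langle J_{E_1}^p x,\,y-x\rangle ,$$ and for $C\subseteq E_1$ let $\Pi_Cx$ be the minimizer of $\Delta_p(x,\cdot)$ over $C$. Write $F(\cdot)$ for the set of fixed points. Let $A:E_1\to E_2$ be bounded linear with adjoint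 $A^*:E_2^*\to E_1^*$. Let $T:E_1\to E_1$ be closed ($u_n\to x$ and $Tu_n\to y$ imply $Tx=y$) and left Bregman quasi-nonexpansive ($F(T)\ne\emptyset$ and $\Delta_p(Tx,u)\le\Delta_p(x,u)$ for all $x\in E_1$, $u\in F(T)$). Let $S:E_2\to E_2$ be firmly nonexpansive-like, i.e. $\langle Sx-Sy,\ J_{E_2}^p(x-Sx)-J_{E_2}^p(y-Sy)\rangle\ge0$ for all $x,y\in E_2$. Let $C_q$ be the smallest constant such that $\|f-g\|^q\le\|f\|^q-q\langle g,J_{E_1^*}^qf\rangle+C_q\|g\|^q$ for all $f,g\in E_1^*$. Let $(\gamma_n),(\alpha_n),(\theta_n)$, $n\ge1$, be real sequences with $$0<\gamma_n<\Big(\frac{q}{C_q\|A\|^q}\Big)^{\frac1{q-1}},\qquad \gamma_n\not\to0,\qquad \alpha_n\in[a,b]\subset(0,1),\qquad \theta_n\in[c,d]\subset\mathbb R$$ (the upper bound on $\gamma_n$ being $+\infty$ if $A=0$). Suppose $\Gamma=\{x\in E_1: x\in F(T),\ Ax\in F(S)\}\neq\emptyset$. Then for all $x_0,x_1\in E_1$,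 with $C_1=E_1$, the iteration ($n\ge1$) $$\begin{aligned} w_n&=J_{E_1^*}^q\big(J_{E_1}^px_n+\theta_nJ_{E_1}^p(x_n-x_{n-1})\big),\\ z_n&=J_{E_1^*}^q\big(J_{E_1}^pw_n-\gamma_nA^*J_{E_2}^p(I-S)Aw_n\big),\\ y_n&=J_{E_1^*}^q\big(\alpha_nJ_{E_1}^pz_n+(1-\alpha_n)J_{E_1}^pTz_n\big),\\ C_{n+1}&=\{u\in C_n:\Delta_p(y_n,u)\le\Delta_p(z_n,u)\le\Delta_p(w_n,u)\},\\ x_{n+1}&=\Pi_{C_{n+1}}x_0 \end{aligned}$$ is well defined, the projection $\Pi_\Gamma x_0\in\Gamma$ exists and is unique, and $x_n\to\Pi_\Gamma x_0$ in norm. -/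

import Mathlib

open Filter Topology
open scoped ENNReal

noncomputable section

namespace InertialSplit

section Space

variable (E : Type*) [NormedAddCommGroup E] [NormedSpace ℝ E]

/-- Modulus of convexity `δ_E(ε) = inf {1 - ‖x + y‖ / 2 : ‖x‖ ≤ 1, ‖y‖ ≤ 1, ‖x - y‖ ≥ ε}`,
with values in `[0, ∞]` so that the infimum over the empty set is `∞`. -/
def modulusConvexity (ε : ℝ) : ℝ≥0∞ :=
  ⨅ (x : E) (y : E) (_ : ‖x‖ ≤ 1) (_ : ‖y‖ ≤ 1) (_ : ε ≤ ‖x - y‖),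
    ENNReal.ofReal (1 - ‖x + y‖ / 2)

/-- Modulus of smoothness `ρ_E(t) = sup {(‖x + y‖ + ‖x - y‖) / 2 - 1 : ‖x‖ ≤ 1, ‖y‖ ≤ t}`,
with values in `[0, ∞]`. -/
def modulusSmoothness (t : ℝ) : ℝ≥0∞ :=
  ⨆ (x : E) (y : E) (_ : ‖x‖ ≤ 1) (_ : ‖y‖ ≤ t),
    ENNReal.ofReal ((‖x + y‖ + ‖x - y‖) / 2 - 1)

/-- `E` is `p`-uniformly convex. -/
def PUniformlyConvex (p : ℝ) : Prop :=
  ∃ c : ℝ, 0 < c ∧ ∀ ε : ℝ, 0 < ε → ε ≤ 2 → ENNReal.ofReal (c * ε ^ p) < modulusConvexity E ε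

/-- `E` is uniformly smooth. -/
def UniformlySmooth : Prop :=
  Tendsto (fun t : ℝ => modulusSmoothness E t / ENNReal.ofReal t) (𝓝[>] 0) (𝓝 0)

variable {E}

/-- The (set-valued) duality mapping `J_E^p`. -/
def dualityMap (p : ℝ) (x : E) : Set (StrongDual ℝ E) :=
  {f | f x = ‖x‖ ^ p ∧ ‖f‖ = ‖x‖ ^ (p - 1)}

lemma dualityMap_nonempty {p : ℝ} (hp : 1 < p) (x : E) : (dualityMap p x).Nonempty := by
  by_cases hx : x = 0
  · refine ⟨0, ?_, ?_⟩
    · simp [hx, Real.zero_rpow (by linarith : p ≠ 0)]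
    · simp [hx, Real.zero_rpow (by linarith : p - 1 ≠ 0)]
  · obtain ⟨g, hg, hgx⟩ := exists_dual_vector ℝ x (norm_ne_zero_iff.mpr hx)
    have hx' : 0 < ‖x‖ := norm_pos_iff.mpr hx
    refine ⟨‖x‖ ^ (p - 1) • g, ?_, ?_⟩
    · have : g x = ‖x‖ := by simpa using hgx
      simp only [smul_apply, smul_eq_mul, this]
      nth_rewrite 2 [← Real.rpow_one ‖x‖]
      rw [← Real.rpow_add hx']
      simp
    · rw [norm_smul, hg, mul_one, Real.norm_of_nonneg (by positivity)]

/-- The duality mapping as a single-valued map: an element of `dualityMap p x`, which is the only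
one when `E` is smooth. -/
def J (p : ℝ) (x : E) : StrongDual ℝ E :=
  Classical.epsilon fun f => f ∈ dualityMap p x

lemma J_mem {p : ℝ} (hp : 1 < p) (x : E) : J p x ∈ dualityMap p x :=
  Classical.epsilon_spec (dualityMap_nonempty hp x)

/-- `x = J_{E*}^q φ` with values in `E`, where `E` is identified with its canonical image
in `E**`. -/
def IsDualJ (q : ℝ) (φ : StrongDual ℝ E) (x : E) : Prop :=
  NormedSpace.inclusionInDoubleDual ℝ E x ∈ dualityMap q φ

/-- The Bregman distance `Δ_p(x, y) = f(y) - f(x) - ⟨f'(x), y - x⟩` of `f = ‖·‖ ^ p / p`,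
whose derivative at `x` is `J p x`. -/
def bregman (p : ℝ) (x y : E) : ℝ :=
  ‖y‖ ^ p / p - ‖x‖ ^ p / p - J p x (y - x)

/-- `z` is a Bregman projection of `x` onto `C`: a minimizer of `Δ_p(x, ·)` over `C`. -/
def IsBregmanProj (p : ℝ) (C : Set E) (x z : E) : Prop :=
  z ∈ C ∧ ∀ y ∈ C, bregman p x z ≤ bregman p x y

/-- Left Bregman quasi-nonexpansive mapping. -/
def LeftBregmanQuasiNonexpansive (p : ℝ) (T : E → E) : Prop :=
  (Function.fixedPoints T).Nonempty ∧
    ∀ x : E, ∀ u ∈ Function.fixedPoints T, bregman p (T x) u ≤ bregman p x u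

/-- Closed mapping (mapping with closed graph). -/
def ClosedMapping (T : E → E) : Prop :=
  ∀ (u : ℕ → E) (x y : E), Tendsto u atTop (𝓝 x) → Tendsto (fun n => T (u n)) atTop (𝓝 y) →
    T x = y

/-- Firmly nonexpansive-like mapping. -/
def FirmlyNonexpansiveLike (p : ℝ) (S : E → E) : Prop :=
  ∀ x y : E, 0 ≤ (J p (x - S x) - J p (y - S y)) (S x - S y)

variable (E) in
/-- The `q`-uniform smoothness constant `C_q` of `E`: the best constant in
`‖x - y‖ ^ q ≤ ‖x‖ ^ q - q ⟨y, J_E^q x⟩ + C_q ‖y‖ ^ q`. -/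
def smoothnessConst (q : ℝ) : ℝ :=
  sInf {C : ℝ | 0 ≤ C ∧
    ∀ x y : E, ‖x - y‖ ^ q ≤ ‖x‖ ^ q - q * J q x y + C * ‖y‖ ^ q}

end Space

section Algorithm

variable {E₁ E₂ : Type*} [NormedAddCommGroup E₁] [NormedSpace ℝ E₁]
  [NormedAddCommGroup E₂] [NormedSpace ℝ E₂]

/-- The solution set `Γ = {x : x ∈ F(T), A x ∈ F(S)}`. -/
def solutionSet (A : E₁ →L[ℝ] E₂) (T : E₁ → E₁) (S : E₂ → E₂) : Set E₁ :=
  {x | x ∈ Function.fixedPoints T ∧ A x ∈ Function.fixedPoints S}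

/-- `x`, `w`, `z`, `y`, `C` are generated by the inertial shrinking projection algorithm from the
initial values `x₀`, `x₁`. The adjoint `A*` sends `φ` to `φ ∘ A`. The values `w 0`, `z 0`, `y 0`,
`C 0` play no role. -/
structure IsGenerated (p q : ℝ) (A : E₁ →L[ℝ] E₂) (T : E₁ → E₁) (S : E₂ → E₂)
    (γ α θ : ℕ → ℝ) (x₀ x₁ : E₁) (x w z y : ℕ → E₁) (C : ℕ → Set E₁) : Prop where
  x_zero : x 0 = x₀
  x_one : x 1 = x₁
  C_one : C 1 = Set.univ
  w_step : ∀ n, 1 ≤ n → IsDualJ q (J p (x n) + θ n • J p (x n - x (n - 1))) (w n)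
  z_step : ∀ n, 1 ≤ n →
    IsDualJ q (J p (w n) - γ n • (J p (A (w n) - S (A (w n)))).comp A) (z n)
  y_step : ∀ n, 1 ≤ n → IsDualJ q (α n • J p (z n) + (1 - α n) • J p (T (z n))) (y n)
  C_step : ∀ n, 1 ≤ n → C (n + 1) =
    {u ∈ C n | bregman p (y n) u ≤ bregman p (z n) u ∧ bregman p (z n) u ≤ bregman p (w n) u}
  x_step : ∀ n, 1 ≤ n → IsBregmanProj p (C (n + 1)) x₀ (x (n + 1))

end Algorithm

end InertialSplit

end

/-! Two quantitative facts about `E₁` carry the proof. Uniform convexity of power type yields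
`PowerConvex`, a midpoint inequality for `‖·‖ ^ p` with error `κ * ‖x - y‖ ^ p`. From it follow
convergence of minimizing sequences, surjectivity of the duality mapping, the bound of `‖x - y‖ ^ p`
by the Bregman distance, and, by Fenchel duality, the smoothness inequality of the dual that makes
`smoothnessConst` meaningful. Uniform smoothness makes `J` single-valued and norm continuous.

In the form `bregman_eq`, a difference of two Bregman distances to a common point is affine in that
point, so every `C n` is closed and convex. The bound on `γ n` and the quasi-nonexpansiveness of `T`
keep the solution set inside `C n` (`PowerConvex.shrinking_sets`). Hence the Bregman distances from
`x₀` to its successive projections increase and stay bounded, and the midpoint inequality turns this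
into a Cauchy property.

The sequences `w`, `z`, `y` then share the limit of `x`. Comparing their images under `J` recovers
the residuals of `T` and `S`, so the limit is a solution, and minimality passes to the limit. -/

namespace InertialSplit

/-! ### Uniform convexity of the `p`-th power of the norm -/

section PowerConvexity

/-- A scalar Clarkson inequality: write `a ^ p = (a ^ 2) ^ (p / 2)`, then use superadditivity and
convexity of `t ^ (p / 2)` around the parallelogram identity. -/
lemma midpoint_rpow_add_le {p r : ℝ} (hp : 2 ≤ p) (hr0 : 0 ≤ r) (hr1 : r ≤ 1) :
    ((1 + r) / 2) ^ p + ((1 - r) / 2) ^ p ≤ (1 + r ^ p) / 2 := by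
  have hsq : ∀ a : ℝ, 0 ≤ a → a ^ p = (a ^ 2) ^ (p / 2) := fun a ha => by
    rw [← Real.rpow_natCast a 2, ← Real.rpow_mul ha]; congr 1; push_cast; ring
  have h1 : (1 : ℝ) ≤ p / 2 := by linarith
  have hA : 0 ≤ (1 + r) / 2 := by linarith
  have hB : 0 ≤ (1 - r) / 2 := by linarith
  rw [hsq _ hA, hsq _ hB, hsq _ hr0]
  refine (Real.add_rpow_le_rpow_add (sq_nonneg _) (sq_nonneg _) h1).trans ?_
  have hc := (convexOn_rpow h1).2 (x := (1 : ℝ)) (y := r ^ 2) (by simp)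
    (by simpa using sq_nonneg r) (by norm_num : (0 : ℝ) ≤ 1 / 2) (by norm_num : (0 : ℝ) ≤ 1 / 2)
    (by norm_num)
  simp only [smul_eq_mul, Real.one_rpow] at hc
  have e : ((1 + r) / 2) ^ 2 + ((1 - r) / 2) ^ 2 = 1 / 2 * 1 + 1 / 2 * r ^ 2 := by ring
  rw [e]
  linarith

lemma sub_rpow_le {p a b : ℝ} (hp : 1 ≤ p) (ha : 0 ≤ a) (hb : 0 ≤ b) (hba : b ≤ a) :
    (a - b) ^ p ≤ a ^ p - a ^ (p - 1) * b := by
  rcases ha.eq_or_lt with rfl | ha'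
  · have : b = 0 := le_antisymm hba hb
    simp [this]
  have h0 : 0 ≤ 1 - b / a := by
    have := (div_le_one ha').2 hba
    linarith
  have h1 : 1 - b / a ≤ 1 := by
    have : 0 ≤ b / a := by positivity
    linarith
  have h2 : (1 - b / a) ^ p ≤ 1 - b / a := Real.rpow_le_self_of_le_one h0 h1 hp
  have h3 : a - b = a * (1 - b / a) := by field_simp
  have h4 : a ^ p = a ^ (p - 1) * a := by
    rw [← Real.rpow_add_one ha'.ne']; simp
  rw [h3, Real.mul_rpow ha h0]
  calc a ^ p * (1 - b / a) ^ p ≤ a ^ p * (1 - b / a) := by gcongr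
    _ = a ^ p - a ^ (p - 1) * b := by rw [h4]; field_simp

lemma PUniformlyConvex.exists_norm_add_le {E : Type*} [NormedAddCommGroup E] {p : ℝ} (hp : 2 ≤ p)
    (h : PUniformlyConvex E p) :
    ∃ c : ℝ, 0 < c ∧ ∀ x y : E, ‖x‖ ≤ 1 → ‖y‖ ≤ 1 → ‖x + y‖ / 2 ≤ 1 - c * ‖x - y‖ ^ p := by
  obtain ⟨c, hc, h⟩ := h
  refine ⟨c, hc, fun x y hx hy => ?_⟩
  rcases (norm_nonneg (x - y)).eq_or_lt with h0 | h0
  · rw [← h0, Real.zero_rpow (by linarith)]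
    have := norm_add_le x y
    linarith
  · have h2 : ‖x - y‖ ≤ 2 := (norm_sub_le x y).trans (by linarith)
    have h3 := (h _ h0 h2).trans_le
      ((iInf_le _ x).trans <| (iInf_le _ y).trans <| (iInf_le _ hx).trans <|
        (iInf_le _ hy).trans <| iInf_le _ le_rfl)
    rw [ENNReal.ofReal_lt_ofReal_iff_of_nonneg (by positivity)] at h3
    linarith

variable {E : Type*} [NormedAddCommGroup E] [NormedSpace ℝ E]

variable (E) in
/-- The `p`-th power of the norm is uniformly convex of power type `p`, with constant `κ`. -/
def PowerConvex (p κ : ℝ) : Prop :=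
  ∀ x y : E, ‖(1 / 2 : ℝ) • (x + y)‖ ^ p ≤ (‖x‖ ^ p + ‖y‖ ^ p) / 2 - κ * ‖x - y‖ ^ p

/-- Two sources of strict convexity are combined. The difference of the norms is paid for by
`midpoint_rpow_add_le`, the difference of the directions by the modulus of convexity. The constant
`(1 / 8) ^ p` is small enough for both cases below. -/
lemma powerConvex_normalized {p c : ℝ} (hp : 2 ≤ p) (hc : 0 < c) (hc1 : c ≤ 1)
    (h : ∀ x y : E, ‖x‖ ≤ 1 → ‖y‖ ≤ 1 → ‖x + y‖ / 2 ≤ 1 - c * ‖x - y‖ ^ p)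
    {x y : E} (hy : ‖y‖ = 1) (hx : ‖x‖ ≤ 1) :
    ‖(1 / 2 : ℝ) • (x + y)‖ ^ p ≤ (‖x‖ ^ p + 1) / 2 - c * (1 / 8) ^ p * ‖x - y‖ ^ p := by
  have hp0 : 0 ≤ p := by linarith
  have hm : ‖(1 / 2 : ℝ) • (x + y)‖ = ‖x + y‖ / 2 := by
    rw [norm_smul]; norm_num; ring
  rw [hm]
  have hr0 := norm_nonneg x
  set r := ‖x‖ with hr
  have hcl := midpoint_rpow_add_le hp hr0 hx
  have hε : ‖x - y‖ ≤ 2 := (norm_sub_le x y).trans (by linarith)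
  rcases lt_or_ge r (1 / 2) with hlt | hge
  -- The norms differ by more than `1 / 2`, so the scalar gap `((1 - r) / 2) ^ p` alone suffices.
  · have h1 : ‖x + y‖ / 2 ≤ (1 + r) / 2 := by
      have := norm_add_le x y
      linarith
    have h2 : (‖x + y‖ / 2) ^ p ≤ ((1 + r) / 2) ^ p := by gcongr
    have h3 : (1 / 4 : ℝ) ^ p ≤ ((1 - r) / 2) ^ p :=
      Real.rpow_le_rpow (by norm_num) (by linarith) hp0
    have h4 : c * (1 / 8) ^ p * ‖x - y‖ ^ p ≤ (1 / 4 : ℝ) ^ p := by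
      calc c * (1 / 8) ^ p * ‖x - y‖ ^ p ≤ 1 * (1 / 8) ^ p * 2 ^ p := by gcongr
        _ = (1 / 4 : ℝ) ^ p := by
          rw [one_mul, ← Real.mul_rpow (by norm_num) (by norm_num)]; norm_num
    linarith
  · have hrpos : 0 < r := by linarith
    -- Uniform convexity is applied to the unit vectors `x'` and `y`; then `‖x - y‖ ≤ (1 - r) + ‖x'
    -- - y‖` splits the distance into its radial and angular parts.
    set x' := r⁻¹ • x with hx'
    have hx'n : ‖x'‖ = 1 := by
      rw [hx', norm_smul, norm_inv, Real.norm_of_nonneg hr0, ← hr, inv_mul_cancel₀ hrpos.ne']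
    have hxx : x = r • x' := by rw [hx', smul_smul, mul_inv_cancel₀ hrpos.ne', one_smul]
    set e := ‖x' - y‖ with he
    have he0 : 0 ≤ e := norm_nonneg _
    have hu := h x' y hx'n.le hy.le
    have h1 : ‖x + y‖ / 2 ≤ (1 + r) / 2 - r * c * e ^ p := by
      have : x + y = r • (x' + y) + (1 - r) • y := by
        rw [smul_add, ← hxx, sub_smul, one_smul]; abel
      have h2 : ‖x + y‖ ≤ r * ‖x' + y‖ + (1 - r) := by
        rw [this]
        refine (norm_add_le _ _).trans ?_
        rw [norm_smul, norm_smul, hy, Real.norm_of_nonneg hr0,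
          Real.norm_of_nonneg (by linarith : 0 ≤ 1 - r), mul_one]
      nlinarith
    have hb0 : 0 ≤ r * c * e ^ p := by positivity
    have hb1 : r * c * e ^ p ≤ (1 + r) / 2 := by
      have := norm_nonneg (x + y)
      linarith
    have h2 : (‖x + y‖ / 2) ^ p ≤ ((1 + r) / 2 - r * c * e ^ p) ^ p := by gcongr
    have h3 := sub_rpow_le (by linarith : 1 ≤ p) (by linarith) hb0 hb1
    have h4 : (1 / 2 : ℝ) ^ (p - 1) ≤ ((1 + r) / 2) ^ (p - 1) := by
      gcongr <;> linarith
    have h5 : (1 / 2 : ℝ) ^ p * c * e ^ p ≤ ((1 + r) / 2) ^ (p - 1) * (r * c * e ^ p) := by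
      calc (1 / 2 : ℝ) ^ p * c * e ^ p = (1 / 2 : ℝ) ^ (p - 1) * ((1 / 2) * c * e ^ p) := by
            rw [Real.rpow_sub_one (by norm_num)]; ring
        _ ≤ _ := by gcongr
    have h6 : ((1 - r) / 2) ^ p = (1 / 2) ^ p * (1 - r) ^ p := by
      rw [← Real.mul_rpow (by norm_num) (by linarith)]; congr 1; ring
    have h7 : ‖x - y‖ ≤ (1 - r) + e := by
      have h8 : x - y = (x' - y) - (1 - r) • x' := by
        rw [sub_smul, one_smul, ← hxx]; abel
      rw [h8]
      refine (norm_sub_le _ _).trans ?_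
      rw [norm_smul, hx'n, Real.norm_of_nonneg (by linarith : 0 ≤ 1 - r)]
      linarith
    have h9 : ((1 / 2) * ‖x - y‖) ^ p ≤ (1 - r) ^ p + e ^ p := by
      have hle : (1 / 2) * ‖x - y‖ ≤ max (1 - r) e := by
        have := le_max_left (1 - r) e
        have := le_max_right (1 - r) e
        linarith
      have hnn : 0 ≤ (1 - r) ^ p := Real.rpow_nonneg (by linarith) _
      have hnn' : 0 ≤ e ^ p := by positivity
      refine (Real.rpow_le_rpow (by positivity) hle hp0).trans ?_
      rcases max_choice (1 - r) e with hh | hh <;> rw [hh] <;> linarith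
    have h10 : c * (1 / 8) ^ p * ‖x - y‖ ^ p ≤ c * (1 / 2) ^ p * ((1 / 2) * ‖x - y‖) ^ p := by
      rw [mul_assoc, mul_assoc, ← Real.mul_rpow (by norm_num) (by positivity),
        ← Real.mul_rpow (by norm_num) (by positivity)]
      have := norm_nonneg (x - y)
      exact mul_le_mul_of_nonneg_left
        (Real.rpow_le_rpow (by positivity) (by linarith) hp0) hc.le
    have h11 : c * (1 / 2) ^ p * ((1 / 2) * ‖x - y‖) ^ p ≤
        c * (1 / 2) ^ p * ((1 - r) ^ p + e ^ p) := by gcongr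
    have h12 : c * (1 / 2) ^ p * (1 - r) ^ p ≤ 1 * (1 / 2) ^ p * (1 - r) ^ p := by
      have hnn : 0 ≤ (1 - r) ^ p := Real.rpow_nonneg (by linarith) _
      gcongr
    nlinarith

lemma PUniformlyConvex.exists_powerConvex {p : ℝ} (hp : 2 ≤ p) (h : PUniformlyConvex E p) :
    ∃ κ : ℝ, 0 < κ ∧ PowerConvex E p κ := by
  have hp0 : 0 < p := by linarith
  obtain ⟨c₀, hc₀, h₀⟩ := h.exists_norm_add_le hp
  set c := min c₀ 1
  have hc : 0 < c := lt_min hc₀ one_pos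
  have h : ∀ x y : E, ‖x‖ ≤ 1 → ‖y‖ ≤ 1 → ‖x + y‖ / 2 ≤ 1 - c * ‖x - y‖ ^ p := by
    intro x y hx hy
    refine (h₀ x y hx hy).trans ?_
    gcongr
    exact min_le_left _ _
  have key : ∀ x y : E, ‖x‖ ≤ ‖y‖ → ‖(1 / 2 : ℝ) • (x + y)‖ ^ p ≤
      (‖x‖ ^ p + ‖y‖ ^ p) / 2 - c * (1 / 8) ^ p * ‖x - y‖ ^ p := by
    intro x y hxy
    rcases (norm_nonneg y).eq_or_lt with h0 | h0
    · have hy : y = 0 := norm_eq_zero.1 h0.symm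
      have hx : x = 0 := norm_le_zero_iff.1 (hxy.trans h0.ge)
      simp [hx, hy, Real.zero_rpow hp0.ne']
    · have hs : ∀ v : E, ‖v‖ ^ p = ‖y‖ ^ p * ‖‖y‖⁻¹ • v‖ ^ p := fun v => by
        rw [← Real.mul_rpow (norm_nonneg _) (norm_nonneg _), norm_smul, norm_inv, norm_norm,
          mul_inv_cancel_left₀ h0.ne']
      have h1 := powerConvex_normalized hp hc (min_le_right _ _) h
        (x := ‖y‖⁻¹ • x) (y := ‖y‖⁻¹ • y)
        (by rw [norm_smul, norm_inv, norm_norm, inv_mul_cancel₀ h0.ne'])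
        (by rw [norm_smul, norm_inv, norm_norm, inv_mul_le_iff₀ h0]; simpa using hxy)
      rw [hs ((1 / 2 : ℝ) • (x + y)), hs x, hs (x - y), smul_comm, smul_add, smul_sub]
      have h2 := mul_le_mul_of_nonneg_left h1 (by positivity : 0 ≤ ‖y‖ ^ p)
      linarith
  refine ⟨c * (1 / 8) ^ p, by positivity, fun x y => ?_⟩
  rcases le_total ‖x‖ ‖y‖ with hxy | hxy
  · exact key x y hxy
  · have := key y x hxy
    rwa [add_comm y x, norm_sub_rev, add_comm (‖y‖ ^ p)] at this

end PowerConvexity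

/-! ### Fenchel–Young equality, minimizers and the inverse duality mapping -/

section Duality

lemma cauchySeq_of_norm_sub_rpow_le {E : Type*} [NormedAddCommGroup E] {p : ℝ} (hp : 0 < p)
    {u : ℕ → E} {b : ℕ → ℝ}
    (h : ∀ N m n, N ≤ m → N ≤ n → ‖u m - u n‖ ^ p ≤ b N) (hb : Tendsto b atTop (𝓝 0)) :
    CauchySeq u := by
  rw [Metric.cauchySeq_iff]
  intro ε hε
  obtain ⟨N, hN⟩ := (hb.eventually (gt_mem_nhds (Real.rpow_pos_of_pos hε p))).exists
  refine ⟨N, fun m hm n hn => ?_⟩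
  rw [dist_eq_norm]
  exact (Real.rpow_lt_rpow_iff (norm_nonneg _) hε.le hp).1 ((h N m n hm hn).trans_lt hN)

variable {E : Type*} [NormedAddCommGroup E] [NormedSpace ℝ E] {p q κ : ℝ}

lemma apply_le_rpow (hpq : p.HolderConjugate q) (f : StrongDual ℝ E) (y : E) :
    f y ≤ ‖y‖ ^ p / p + ‖f‖ ^ q / q := by
  refine (le_abs_self _).trans ((f.le_opNorm y).trans ?_)
  rw [mul_comm]
  exact Real.young_inequality_of_nonneg (norm_nonneg _) (norm_nonneg _) hpq

lemma norm_rpow_of_mem_dualityMap (hpq : p.HolderConjugate q) {x : E} {f : StrongDual ℝ E}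
    (hf : f ∈ dualityMap p x) : ‖f‖ ^ q = ‖x‖ ^ p := by
  rw [hf.2, ← Real.rpow_mul (norm_nonneg _), hpq.sub_one_mul_conj]

lemma apply_eq_of_mem_dualityMap (hpq : p.HolderConjugate q) {x : E} {f : StrongDual ℝ E}
    (hf : f ∈ dualityMap p x) : f x = ‖x‖ ^ p / p + ‖f‖ ^ q / q := by
  rw [norm_rpow_of_mem_dualityMap hpq hf, hf.1, div_eq_mul_inv, div_eq_mul_inv, ← mul_add,
    hpq.inv_add_inv_eq_one, mul_one]

lemma apply_sub_le_of_mem_dualityMap (hpq : p.HolderConjugate q) {x : E} {f : StrongDual ℝ E}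
    (hf : f ∈ dualityMap p x) (y : E) : f (y - x) ≤ ‖y‖ ^ p / p - ‖x‖ ^ p / p := by
  have h1 := apply_le_rpow hpq f y
  have h2 := apply_eq_of_mem_dualityMap hpq hf
  rw [map_sub]
  linarith

lemma bregman_eq (hpq : p.HolderConjugate q) (x y : E) :
    bregman p x y = ‖y‖ ^ p / p + ‖J p x‖ ^ q / q - J p x y := by
  have h2 := apply_eq_of_mem_dualityMap hpq (J_mem hpq.lt x)
  rw [bregman, map_sub]
  linarith

/-- The subgradient inequality is tested at the midpoint of `x` and `y`; doubling the gain in the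
midpoint inequality gives the factor `2`. -/
lemma PowerConvex.rpow_le_of_mem_dualityMap (hM : PowerConvex E p κ)
    (hpq : p.HolderConjugate q) {x : E} {f : StrongDual ℝ E} (hf : f ∈ dualityMap p x) (y : E) :
    2 * κ / p * ‖x - y‖ ^ p ≤ ‖y‖ ^ p / p - ‖x‖ ^ p / p - f (y - x) := by
  have h1 := apply_sub_le_of_mem_dualityMap hpq hf ((1 / 2 : ℝ) • (x + y))
  have h2 : (1 / 2 : ℝ) • (x + y) - x = (1 / 2 : ℝ) • (y - x) := by module
  rw [h2, map_smul, smul_eq_mul] at h1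
  have h3 := div_le_div_of_nonneg_right (hM x y) hpq.pos.le
  have e1 : ((‖x‖ ^ p + ‖y‖ ^ p) / 2 - κ * ‖x - y‖ ^ p) / p
      = (‖x‖ ^ p / p + ‖y‖ ^ p / p) / 2 - κ / p * ‖x - y‖ ^ p := by ring
  have e2 : 2 * κ / p * ‖x - y‖ ^ p = 2 * (κ / p * ‖x - y‖ ^ p) := by ring
  rw [e1] at h3
  rw [e2]
  linarith

lemma PowerConvex.rpow_le_bregman (hM : PowerConvex E p κ) (hpq : p.HolderConjugate q) (x y : E) :
    2 * κ / p * ‖x - y‖ ^ p ≤ bregman p x y :=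
  hM.rpow_le_of_mem_dualityMap hpq (J_mem hpq.lt x) y

lemma mem_dualityMap_of_isDualJ (hpq : p.HolderConjugate q) {φ : StrongDual ℝ E} {x : E}
    (h : IsDualJ q φ x) : φ ∈ dualityMap p x := by
  obtain ⟨h1, h2⟩ := h
  rw [NormedSpace.dual_def] at h1
  have h2 : ‖x‖ = ‖φ‖ ^ (q - 1) := by
    rw [← h2]; exact ((NormedSpace.inclusionInDoubleDualLi ℝ).norm_map x).symm
  refine ⟨?_, ?_⟩
  · rw [h1, h2, ← Real.rpow_mul (norm_nonneg _), hpq.symm.sub_one_mul_conj]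
  · rw [h2, ← Real.rpow_mul (norm_nonneg _)]
    have : (q - 1) * (p - 1) = 1 := by
      have := hpq.symm.sub_one_mul_conj
      have := hpq.mul_eq_add
      linarith
    rw [this, Real.rpow_one]

lemma PowerConvex.midpoint_le (hM : PowerConvex E p κ) (hp : 0 < p) (φ : StrongDual ℝ E)
    (x y : E) : κ / p * ‖x - y‖ ^ p ≤
      ((‖x‖ ^ p / p - φ x) + (‖y‖ ^ p / p - φ y)) / 2
        - (‖(1 / 2 : ℝ) • (x + y)‖ ^ p / p - φ ((1 / 2 : ℝ) • (x + y))) := by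
  have h3 := div_le_div_of_nonneg_right (hM x y) hp.le
  have e1 : ((‖x‖ ^ p + ‖y‖ ^ p) / 2 - κ * ‖x - y‖ ^ p) / p
      = (‖x‖ ^ p / p + ‖y‖ ^ p / p) / 2 - κ / p * ‖x - y‖ ^ p := by ring
  rw [e1] at h3
  rw [map_smul, map_add, smul_eq_mul]
  linarith

lemma midpoint_mem {C : Set E} (hC : Convex ℝ C) {x y : E} (hx : x ∈ C) (hy : y ∈ C) :
    (1 / 2 : ℝ) • (x + y) ∈ C := by
  rw [smul_add]
  exact hC hx hy (by norm_num) (by norm_num) (by norm_num)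

/-- Midpoints of a minimizing sequence stay in `C`, so the midpoint inequality forces the sequence
to be Cauchy; no weak compactness enters. -/
lemma PowerConvex.exists_minimizer [CompleteSpace E] (hM : PowerConvex E p κ) (hκ : 0 < κ)
    (hpq : p.HolderConjugate q) (φ : StrongDual ℝ E) {C : Set E} (hC : IsClosed C)
    (hCc : Convex ℝ C) (hCn : C.Nonempty) :
    ∃ z ∈ C, ∀ y ∈ C, ‖z‖ ^ p / p - φ z ≤ ‖y‖ ^ p / p - φ y := by
  have hp := hpq.pos
  set F : E → ℝ := fun y => ‖y‖ ^ p / p - φ y with hF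
  have hFc : Continuous F := by
    have : Continuous fun y : E => ‖y‖ ^ p := continuous_norm.rpow_const fun _ => Or.inr hp.le
    fun_prop
  have hbdd : BddBelow (F '' C) := by
    refine ⟨-(‖φ‖ ^ q / q), ?_⟩
    rintro _ ⟨y, -, rfl⟩
    have := apply_le_rpow hpq φ y
    simp only [hF]
    linarith
  set m := sInf (F '' C)
  have hm : ∀ y ∈ C, m ≤ F y := fun y hy => csInf_le hbdd ⟨y, hy, rfl⟩
  have hu : ∀ n : ℕ, ∃ u ∈ C, F u < m + 1 / ((n : ℝ) + 1) := by
    intro n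
    obtain ⟨_, ⟨u, hu, rfl⟩, h⟩ := exists_lt_of_csInf_lt (hCn.image F)
      (lt_add_of_pos_right m (Nat.one_div_pos_of_nat (n := n)))
    exact ⟨u, hu, h⟩
  choose u huC hu using hu
  have hcs : CauchySeq u := by
    refine cauchySeq_of_norm_sub_rpow_le hp (b := fun N => p / κ * (1 / ((N : ℝ) + 1))) ?_ ?_
    · intro N k n hk hn
      have h1 := hM.midpoint_le hp φ (u k) (u n)
      have h2 := hm _ (midpoint_mem hCc (huC k) (huC n))
      have h3 := hu k
      have h4 := hu n
      have h5 : 1 / ((k : ℝ) + 1) ≤ 1 / ((N : ℝ) + 1) := by gcongr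
      have h6 : 1 / ((n : ℝ) + 1) ≤ 1 / ((N : ℝ) + 1) := by gcongr
      have h7 : κ / p * ‖u k - u n‖ ^ p ≤ 1 / ((N : ℝ) + 1) := by
        simp only [hF] at h2 h3 h4
        linarith
      calc ‖u k - u n‖ ^ p = p / κ * (κ / p * ‖u k - u n‖ ^ p) := by field_simp
        _ ≤ _ := by gcongr
    · simpa using (tendsto_one_div_add_atTop_nhds_zero_nat (𝕜 := ℝ)).const_mul (p / κ)
  obtain ⟨z, hz⟩ := cauchySeq_tendsto_of_complete hcs
  refine ⟨z, hC.mem_of_tendsto hz (Eventually.of_forall huC), fun y hy => ?_⟩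
  have hlim : Tendsto (fun n : ℕ => m + 1 / ((n : ℝ) + 1)) atTop (𝓝 m) := by
    simpa using (tendsto_one_div_add_atTop_nhds_zero_nat (𝕜 := ℝ)).const_add m
  exact (le_of_tendsto_of_tendsto' ((hFc.tendsto z).comp hz) hlim fun n => (hu n).le).trans
    (hm y hy)

/-- This stands in for reflexivity. The point of least norm in the half-space `1 ≤ φ y` is a vector
where `φ` attains its norm, and a rescaling by `‖φ‖ ^ q` gives the right length. -/
lemma PowerConvex.exists_isDualJ [CompleteSpace E] (hM : PowerConvex E p κ) (hκ : 0 < κ)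
    (hpq : p.HolderConjugate q) (φ : StrongDual ℝ E) : ∃ x, IsDualJ q φ x := by
  have hq := hpq.symm.pos
  rcases eq_or_ne φ 0 with rfl | hφ
  · refine ⟨0, ?_, ?_⟩
    · simp [Real.zero_rpow hq.ne']
    · simp [Real.zero_rpow (sub_pos.2 hpq.symm.lt).ne']
  have hφ' : 0 < ‖φ‖ := norm_pos_iff.2 hφ
  have hne : {y : E | 1 ≤ φ y}.Nonempty := by
    obtain ⟨v, hv⟩ : ∃ v, φ v ≠ 0 := by
      by_contra! h
      exact hφ (ContinuousLinearMap.ext h)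
    exact ⟨(φ v)⁻¹ • v, by simp [hv]⟩
  obtain ⟨x, hx, hmin⟩ := hM.exists_minimizer hκ hpq 0
    (isClosed_le continuous_const φ.continuous)
    (convex_halfSpace_ge φ.toLinearMap.isLinear 1) hne
  have hx1 : 1 ≤ φ x := hx
  have hmin' : ∀ y, 1 ≤ φ y → ‖x‖ ≤ ‖y‖ := fun y hy => by
    have := hmin y hy
    simp only [zero_apply, sub_zero] at this
    rw [div_le_div_iff_of_pos_right hpq.pos] at this
    exact (Real.rpow_le_rpow_iff (norm_nonneg _) (norm_nonneg _) hpq.pos).1 this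
  have hx0 : 0 < ‖x‖ := by
    rw [norm_pos_iff]; rintro rfl; rw [map_zero] at hx1; linarith
  have hpos : ∀ y, φ y ≤ ‖x‖⁻¹ * ‖y‖ := fun y => by
    rcases le_or_gt (φ y) 0 with h | h
    · exact h.trans (by positivity)
    · have := hmin' ((φ y)⁻¹ • y) (by simp [h.ne'])
      rw [norm_smul, norm_inv, Real.norm_of_nonneg h.le, inv_mul_eq_div, le_div_iff₀ h] at this
      rw [inv_mul_eq_div, le_div_iff₀ hx0]
      linarith
  have hnorm : ‖φ‖ ≤ ‖x‖⁻¹ := φ.opNorm_le_bound (by positivity) fun y => by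
    rw [Real.norm_eq_abs, abs_le]
    refine ⟨?_, hpos y⟩
    have := hpos (-y)
    rw [map_neg, norm_neg] at this
    linarith
  have hprod : ‖φ‖ * ‖x‖ ≤ 1 := by
    calc ‖φ‖ * ‖x‖ ≤ ‖x‖⁻¹ * ‖x‖ := by gcongr
      _ = 1 := inv_mul_cancel₀ hx0.ne'
  have hle : φ x ≤ ‖φ‖ * ‖x‖ := (le_abs_self _).trans (φ.le_opNorm x)
  have hφx : φ x = 1 := by linarith
  have hnx : ‖x‖ = ‖φ‖⁻¹ := by
    exact eq_inv_of_mul_eq_one_left (by linarith)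
  refine ⟨‖φ‖ ^ q • x, ?_, ?_⟩
  · rw [NormedSpace.dual_def, map_smul, hφx, smul_eq_mul, mul_one]
  · have : ‖NormedSpace.inclusionInDoubleDual ℝ E (‖φ‖ ^ q • x)‖ = ‖‖φ‖ ^ q • x‖ :=
      (NormedSpace.inclusionInDoubleDualLi ℝ).norm_map _
    rw [this, norm_smul, hnx, Real.norm_of_nonneg (by positivity), Real.rpow_sub_one hφ'.ne',
      div_eq_mul_inv]

end Duality

end InertialSplit

namespace InertialSplit

/-! ### Single-valuedness and continuity of the duality mapping -/

section Smoothness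

lemma UniformlySmooth.exists_norm_add_add_norm_sub_le {E : Type*} [NormedAddCommGroup E]
    (h : UniformlySmooth E) {ε : ℝ} (hε : 0 < ε) :
    ∃ t : ℝ, 0 < t ∧ ∀ x y : E, ‖x‖ ≤ 1 → ‖y‖ ≤ t → (‖x + y‖ + ‖x - y‖) / 2 - 1 ≤ ε * t := by
  have h1 := h.eventually (gt_mem_nhds (ENNReal.ofReal_pos.2 hε))
  obtain ⟨t, ht, ht0⟩ := (h1.and self_mem_nhdsWithin).exists
  have ht0 : 0 < t := ht0
  refine ⟨t, ht0, fun x y hx hy => ?_⟩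
  have h2 : ENNReal.ofReal ((‖x + y‖ + ‖x - y‖) / 2 - 1) ≤ modulusSmoothness E t :=
    (le_iSup_of_le x <| le_iSup_of_le y <| le_iSup_of_le hx <| le_iSup_of_le hy le_rfl)
  have h3 : modulusSmoothness E t ≤ ENNReal.ofReal (ε * t) := by
    rw [ENNReal.ofReal_mul hε.le]
    exact (ENNReal.div_le_iff (ENNReal.ofReal_pos.2 ht0).ne' ENNReal.ofReal_ne_top).1 ht.le
  exact (ENNReal.ofReal_le_ofReal_iff (by positivity)).1 (h2.trans h3)

variable {E : Type*} [NormedAddCommGroup E] [NormedSpace ℝ E] {p : ℝ}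

/-- Norming functionals depend continuously on the point, uniformly on the unit sphere. -/
lemma UniformlySmooth.exists_norm_sub_le (h : UniformlySmooth E) {ε : ℝ} (hε : 0 < ε) :
    ∃ t : ℝ, 0 < t ∧ ∀ (x x' : E) (f g : StrongDual ℝ E), ‖x‖ = 1 → ‖f‖ = 1 → ‖g‖ = 1 →
      f x = 1 → g x' = 1 → ‖g - f‖ ≤ 2 * ε + ‖x' - x‖ / t := by
  obtain ⟨t, ht, H⟩ := h.exists_norm_add_add_norm_sub_le hε
  refine ⟨t, ht, fun x x' f g hx hf hg hfx hgx => ?_⟩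
  have hle : ∀ (k : StrongDual ℝ E), ‖k‖ = 1 → ∀ v, k v ≤ ‖v‖ := fun k hk v => by
    have := (le_abs_self _).trans (k.le_opNorm v)
    rwa [hk, one_mul] at this
  have hub : ∀ y : E, ‖y‖ ≤ 1 → (g - f) y ≤ 2 * ε + ‖x' - x‖ / t := by
    intro y hy
    have h1 := H x (t • y) hx.le (by
      rw [norm_smul, Real.norm_of_nonneg ht.le]; exact mul_le_of_le_one_right ht.le hy)
    have h2 := hle g hg (x + t • y)
    have h3 := hle f hf (x - t • y)
    have h4 := hle g hg (x' - x)
    simp only [map_add, map_sub, map_smul, smul_eq_mul] at h2 h3 h4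
    -- Adding the bounds for `g (x + t • y)` and `f (x - t • y)` leaves `1 - g x`, which equals `g
    -- (x' - x)`.
    have h5 : (g - f) y * t ≤ 2 * ε * t + ‖x' - x‖ := by
      rw [sub_apply]
      linarith
    calc (g - f) y = (g - f) y * t / t := by field_simp
      _ ≤ (2 * ε * t + ‖x' - x‖) / t := by gcongr
      _ = _ := by field_simp
  refine ContinuousLinearMap.opNorm_le_of_unit_norm (by positivity) fun y hy => ?_
  rw [Real.norm_eq_abs, abs_le]
  refine ⟨?_, hub y hy.le⟩
  have := hub (-y) (by rw [norm_neg]; exact hy.le)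
  rw [map_neg] at this
  linarith

lemma normalize_mem_dualityMap {x : E} (hx : x ≠ 0) {f : StrongDual ℝ E}
    (hf : f ∈ dualityMap p x) :
    ‖(‖x‖ ^ (p - 1))⁻¹ • f‖ = 1 ∧ ((‖x‖ ^ (p - 1))⁻¹ • f) (‖x‖⁻¹ • x) = 1 := by
  have hx' : 0 < ‖x‖ := norm_pos_iff.2 hx
  have hpow : 0 < ‖x‖ ^ (p - 1) := Real.rpow_pos_of_pos hx' _
  refine ⟨?_, ?_⟩
  · rw [norm_smul, hf.2, norm_inv, Real.norm_of_nonneg hpow.le, inv_mul_cancel₀ hpow.ne']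
  · rw [smul_apply, map_smul, hf.1, smul_eq_mul, smul_eq_mul, Real.rpow_sub_one hx'.ne']
    have : 0 < ‖x‖ ^ p := Real.rpow_pos_of_pos hx' _
    field_simp

lemma norm_normalize {x : E} (hx : x ≠ 0) : ‖‖x‖⁻¹ • x‖ = 1 := by
  rw [norm_smul, norm_inv, norm_norm, inv_mul_cancel₀ (norm_ne_zero_iff.2 hx)]

lemma UniformlySmooth.eq_of_mem_dualityMap (h : UniformlySmooth E) (hp : 1 < p) {x : E}
    {f g : StrongDual ℝ E} (hf : f ∈ dualityMap p x) (hg : g ∈ dualityMap p x) : f = g := by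
  rcases eq_or_ne x 0 with rfl | hx
  · have h0 : ∀ k ∈ dualityMap p (0 : E), k = 0 := fun k hk => by
      have := hk.2
      rwa [norm_zero, Real.zero_rpow (by linarith), norm_eq_zero] at this
    rw [h0 f hf, h0 g hg]
  have hpow : 0 < ‖x‖ ^ (p - 1) := Real.rpow_pos_of_pos (norm_pos_iff.2 hx) _
  obtain ⟨hf1, hf2⟩ := normalize_mem_dualityMap hx hf
  obtain ⟨hg1, hg2⟩ := normalize_mem_dualityMap hx hg
  have hle : ‖(‖x‖ ^ (p - 1))⁻¹ • g - (‖x‖ ^ (p - 1))⁻¹ • f‖ ≤ 0 := by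
    refine le_of_forall_pos_le_add fun ε hε => ?_
    obtain ⟨t, -, H⟩ := h.exists_norm_sub_le (half_pos hε)
    have := H _ _ _ _ (norm_normalize hx) hf1 hg1 hf2 hg2
    rw [sub_self, norm_zero, zero_div] at this
    linarith
  have := sub_eq_zero.1 (norm_le_zero_iff.1 hle)
  exact (smul_right_injective _ (inv_pos.2 hpow).ne' this).symm

lemma UniformlySmooth.J_eq (h : UniformlySmooth E) (hp : 1 < p) {x : E} {f : StrongDual ℝ E}
    (hf : f ∈ dualityMap p x) : J p x = f :=
  h.eq_of_mem_dualityMap hp (J_mem hp x) hf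

lemma J_zero (hp : 1 < p) : J p (0 : E) = 0 := by
  have := (J_mem hp (0 : E)).2
  rwa [norm_zero, Real.zero_rpow (by linarith), norm_eq_zero] at this

lemma tendsto_J_zero {ι : Type*} {l : Filter ι} {u : ι → E} (hp : 1 < p)
    (hu : Tendsto u l (𝓝 0)) : Tendsto (fun i => J p (u i)) l (𝓝 0) := by
  rw [tendsto_zero_iff_norm_tendsto_zero] at hu ⊢
  simp_rw [fun i => (J_mem hp (u i)).2]
  have := hu.rpow_const (p := p - 1) (Or.inr (by linarith))
  rwa [Real.zero_rpow (by linarith)] at this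

lemma UniformlySmooth.continuous_J (h : UniformlySmooth E) (hp : 1 < p) :
    Continuous (J p : E → StrongDual ℝ E) := by
  rw [continuous_iff_continuousAt]
  intro x
  rcases eq_or_ne x 0 with rfl | hx
  · rw [ContinuousAt, J_zero hp]
    exact tendsto_J_zero hp tendsto_id
  have hx' : 0 < ‖x‖ := norm_pos_iff.2 hx
  have hne : ∀ᶠ y in 𝓝 x, y ≠ 0 := isOpen_ne.mem_nhds hx
  have hdir : Tendsto (fun y : E => ‖‖y‖⁻¹ • y - ‖x‖⁻¹ • x‖) (𝓝 x) (𝓝 0) := by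
    rw [← tendsto_iff_norm_sub_tendsto_zero]
    exact ((continuous_norm.tendsto x).inv₀ hx'.ne').smul tendsto_id
  have hN : Tendsto (fun y : E => (‖y‖ ^ (p - 1))⁻¹ • J p y) (𝓝 x)
      (𝓝 ((‖x‖ ^ (p - 1))⁻¹ • J p x)) := by
    rw [Metric.tendsto_nhds]
    intro ε hε
    obtain ⟨t, ht, H⟩ := h.exists_norm_sub_le (by positivity : 0 < ε / 4)
    filter_upwards [hne, hdir.eventually (gt_mem_nhds (by positivity : 0 < ε / 2 * t))]
      with y hy hyx
    obtain ⟨hf1, hf2⟩ := normalize_mem_dualityMap hx (J_mem hp x)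
    obtain ⟨hg1, hg2⟩ := normalize_mem_dualityMap hy (J_mem hp y)
    have := H _ _ _ _ (norm_normalize hx) hf1 hg1 hf2 hg2
    rw [← div_lt_iff₀ ht] at hyx
    rw [dist_eq_norm]
    linarith
  have hpw : Tendsto (fun y : E => ‖y‖ ^ (p - 1)) (𝓝 x) (𝓝 (‖x‖ ^ (p - 1))) :=
    (continuous_norm.tendsto x).rpow_const (Or.inl hx'.ne')
  have hcancel : ∀ y : E, y ≠ 0 → ‖y‖ ^ (p - 1) • (‖y‖ ^ (p - 1))⁻¹ • J p y = J p y :=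
    fun y hy => smul_inv_smul₀ (Real.rpow_pos_of_pos (norm_pos_iff.2 hy) _).ne' _
  have := hpw.smul hN
  rw [hcancel x hx] at this
  refine this.congr' ?_
  filter_upwards [hne] with y hy using hcancel y hy

end Smoothness

/-! ### Smoothness of the dual norm and existence of projections -/

section DualSmoothness

variable {E : Type*} [NormedAddCommGroup E] [NormedSpace ℝ E] [CompleteSpace E] {p q κ : ℝ}

/-- Convexity of power type `p` dualizes to smoothness of power type `q`: with `f - g` dual to some
`y`, the Fenchel–Young equalities at `x` and `y` reduce the claim to a bound on `g (x - y)`. -/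
lemma PowerConvex.exists_dual_smooth (hM : PowerConvex E p κ) (hκ : 0 < κ)
    (hpq : p.HolderConjugate q) :
    ∃ C : ℝ, 0 ≤ C ∧ ∀ (x : E) (f g : StrongDual ℝ E), f ∈ dualityMap p x →
      ‖f - g‖ ^ q ≤ ‖f‖ ^ q - q * g x + C * ‖g‖ ^ q := by
  have hq := hpq.symm.pos
  -- This weight makes the `‖x - y‖ ^ p` term from Young's inequality cancel the gain from uniform
  -- convexity.
  set l : ℝ := (2 * κ) ^ (1 / p) with hl
  have hl0 : 0 < l := by positivity
  have hlp : l ^ p = 2 * κ := by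
    rw [hl, ← Real.rpow_mul (by positivity), one_div_mul_cancel hpq.ne_zero, Real.rpow_one]
  refine ⟨(l⁻¹) ^ q, by positivity, fun x f g hf => ?_⟩
  obtain ⟨y, hy⟩ := hM.exists_isDualJ hκ hpq (f - g)
  have h1 := apply_eq_of_mem_dualityMap hpq (mem_dualityMap_of_isDualJ hpq hy)
  have h2 := apply_eq_of_mem_dualityMap hpq hf
  have h3 := hM.rpow_le_of_mem_dualityMap hpq hf y
  have h4 : g (x - y) ≤ 2 * κ / p * ‖x - y‖ ^ p + (l⁻¹) ^ q * ‖g‖ ^ q / q := by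
    calc g (x - y) ≤ ‖g‖ * ‖x - y‖ := (le_abs_self _).trans (g.le_opNorm _)
      _ = (l * ‖x - y‖) * (l⁻¹ * ‖g‖) := by field_simp
      _ ≤ (l * ‖x - y‖) ^ p / p + (l⁻¹ * ‖g‖) ^ q / q :=
        Real.young_inequality_of_nonneg (by positivity) (by positivity) hpq
      _ = _ := by
        rw [Real.mul_rpow hl0.le (norm_nonneg _), hlp,
          Real.mul_rpow (inv_pos.2 hl0).le (norm_nonneg _)]
        ring
  simp only [map_sub, sub_apply] at h1 h3 h4
  have h5 : ‖f - g‖ ^ q / q ≤ ‖f‖ ^ q / q - g x + (l⁻¹) ^ q * ‖g‖ ^ q / q := by linarith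
  have h6 := mul_le_mul_of_nonneg_left h5 hq.le
  have e1 : q * (‖f - g‖ ^ q / q) = ‖f - g‖ ^ q := by field_simp
  have e2 : q * (‖f‖ ^ q / q - g x + (l⁻¹) ^ q * ‖g‖ ^ q / q) =
      ‖f‖ ^ q - q * g x + (l⁻¹) ^ q * ‖g‖ ^ q := by field_simp
  rwa [e1, e2] at h6

/-- Identifies the choice made by `J q` on the dual with evaluation at `x`. The smoothness bound
makes `g x - Φ g` of order `‖g‖ ^ q`; scaling `g` by `t → 0`, with `q > 1`, and then changing its
sign give equality. -/
lemma PowerConvex.apply_eq_of_mem_dualityMap_dual (hM : PowerConvex E p κ) (hκ : 0 < κ)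
    (hpq : p.HolderConjugate q) {x : E} {f : StrongDual ℝ E} (hf : f ∈ dualityMap p x)
    {Φ : StrongDual ℝ (StrongDual ℝ E)} (hΦ : Φ ∈ dualityMap q f) (g : StrongDual ℝ E) :
    Φ g = g x := by
  have hq := hpq.symm.pos
  obtain ⟨C, hC, H⟩ := hM.exists_dual_smooth hκ hpq
  have hle : ∀ g : StrongDual ℝ E, g x - Φ g ≤ C / q * ‖g‖ ^ q := fun g => by
    have h1 := apply_sub_le_of_mem_dualityMap hpq.symm hΦ (f - g)
    have h2 := div_le_div_of_nonneg_right (H x f g hf) hq.le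
    have e : (‖f‖ ^ q - q * g x + C * ‖g‖ ^ q) / q = ‖f‖ ^ q / q - g x + C / q * ‖g‖ ^ q := by
      field_simp
    rw [e] at h2
    rw [sub_sub_cancel_left, map_neg] at h1
    linarith
  have hle0 : ∀ g : StrongDual ℝ E, g x - Φ g ≤ 0 := fun g => by
    have hlim : Tendsto (fun t : ℝ => C / q * ‖g‖ ^ q * t ^ (q - 1)) (𝓝[>] 0) (𝓝 0) := by
      have h0 : Tendsto (fun t : ℝ => t ^ (q - 1)) (𝓝 0) (𝓝 ((0 : ℝ) ^ (q - 1))) :=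
        tendsto_id.rpow_const (Or.inr (sub_pos.2 hpq.symm.lt).le)
      rw [Real.zero_rpow (sub_pos.2 hpq.symm.lt).ne'] at h0
      simpa using (h0.const_mul (C / q * ‖g‖ ^ q)).mono_left nhdsWithin_le_nhds
    refine ge_of_tendsto hlim ?_
    filter_upwards [self_mem_nhdsWithin] with t ht
    have ht : 0 < t := ht
    have h1 := hle (t • g)
    rw [map_smul, smul_apply, smul_eq_mul, smul_eq_mul, norm_smul,
      Real.norm_of_nonneg ht.le, Real.mul_rpow ht.le (norm_nonneg _)] at h1
    have h2 : t ^ q = t * t ^ (q - 1) := by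
      rw [Real.rpow_sub_one ht.ne']; field_simp
    rw [h2] at h1
    refine le_of_mul_le_mul_left ?_ ht
    linarith
  have h1 := hle0 g
  have h2 := hle0 (-g)
  rw [neg_apply, map_neg] at h2
  linarith

/-- The admissible constants form a nonempty closed set bounded below, so the infimum is itself
admissible. -/
lemma PowerConvex.norm_sub_rpow_le_smoothnessConst (hM : PowerConvex E p κ) (hκ : 0 < κ)
    (hpq : p.HolderConjugate q) {x : E} {f : StrongDual ℝ E} (hf : f ∈ dualityMap p x)
    (g : StrongDual ℝ E) :
    ‖f - g‖ ^ q ≤ ‖f‖ ^ q - q * g x + smoothnessConst (StrongDual ℝ E) q * ‖g‖ ^ q := by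
  set s : Set ℝ := {C : ℝ | 0 ≤ C ∧
    ∀ x y : StrongDual ℝ E, ‖x - y‖ ^ q ≤ ‖x‖ ^ q - q * J q x y + C * ‖y‖ ^ q} with hs
  have hne : s.Nonempty := by
    obtain ⟨C, hC, H⟩ := hM.exists_dual_smooth hκ hpq
    refine ⟨C, hC, fun φ ψ => ?_⟩
    obtain ⟨v, hv⟩ := hM.exists_isDualJ hκ hpq φ
    have hv' := mem_dualityMap_of_isDualJ hpq hv
    rw [hM.apply_eq_of_mem_dualityMap_dual hκ hpq hv' (J_mem hpq.symm.lt φ)]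
    exact H v φ ψ hv'
  have hcl : IsClosed s := by
    simp only [hs, Set.ofPred_and, Set.ofPred_forall]
    refine (isClosed_le continuous_const continuous_id).inter ?_
    refine isClosed_iInter fun φ => isClosed_iInter fun ψ => ?_
    exact isClosed_le continuous_const (by fun_prop)
  have hmem : smoothnessConst (StrongDual ℝ E) q ∈ s :=
    hcl.csInf_mem hne ⟨0, fun C hC => hC.1⟩
  have := hmem.2 f g
  rwa [hM.apply_eq_of_mem_dualityMap_dual hκ hpq hf (J_mem hpq.symm.lt f)] at this

lemma PowerConvex.exists_isBregmanProj (hM : PowerConvex E p κ) (hκ : 0 < κ)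
    (hpq : p.HolderConjugate q) (x : E) {C : Set E} (hC : IsClosed C)
    (hCc : Convex ℝ C) (hCn : C.Nonempty) : ∃ z, IsBregmanProj p C x z := by
  obtain ⟨z, hz, h⟩ := hM.exists_minimizer hκ hpq (J p x) hC hCc hCn
  refine ⟨z, hz, fun y hy => ?_⟩
  have := h y hy
  rw [bregman_eq hpq, bregman_eq hpq]
  linarith

end DualSmoothness

/-! ### Bregman distances and projections -/

section Bregman

lemma tendsto_of_tendsto_rpow_norm_sub {E : Type*} [NormedAddCommGroup E] {p : ℝ} {ι : Type*}
    {l : Filter ι} {u v : ι → E} {x : E} {c : ℝ} {b : ι → ℝ} (hp : 0 < p) (hc : 0 < c)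
    (hv : Tendsto v l (𝓝 x))
    (hb : Tendsto b l (𝓝 0)) (h : ∀ᶠ i in l, c * ‖u i - v i‖ ^ p ≤ b i) :
    Tendsto u l (𝓝 x) := by
  have h1 : Tendsto (fun i => ‖u i - v i‖ ^ p) l (𝓝 0) := by
    have h2 : Tendsto (fun i => b i / c) l (𝓝 0) := by simpa using hb.div_const c
    refine squeeze_zero' (Eventually.of_forall fun i => by positivity) ?_ h2
    filter_upwards [h] with i hi
    rw [le_div_iff₀ hc]
    linarith
  have h3 := h1.rpow_const (p := 1 / p) (Or.inr (by positivity))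
  rw [Real.zero_rpow (by positivity)] at h3
  have h4 : Tendsto (fun i => u i - v i) l (𝓝 0) := by
    rw [tendsto_zero_iff_norm_tendsto_zero]
    refine h3.congr fun i => ?_
    rw [← Real.rpow_mul (norm_nonneg _), mul_one_div_cancel hp.ne', Real.rpow_one]
  simpa using h4.add hv

variable {E : Type*} [NormedAddCommGroup E] [NormedSpace ℝ E] {p q κ : ℝ}

/-- The midpoint of `z` and `u` competes in the minimization, so its distance cannot fall below that
of `z`. -/
lemma PowerConvex.rpow_le_bregman_sub (hM : PowerConvex E p κ) (hpq : p.HolderConjugate q)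
    {x z u : E} {C : Set E} (hC : Convex ℝ C) (hz : IsBregmanProj p C x z) (hu : u ∈ C) :
    κ / p * ‖z - u‖ ^ p ≤ (bregman p x u - bregman p x z) / 2 := by
  have h1 := hM.midpoint_le hpq.pos (J p x) z u
  have h2 := hz.2 _ (midpoint_mem hC hz.1 hu)
  rw [bregman_eq hpq, bregman_eq hpq] at h2
  rw [bregman_eq hpq, bregman_eq hpq]
  linarith

lemma PowerConvex.isBregmanProj_unique (hM : PowerConvex E p κ) (hκ : 0 < κ)
    (hpq : p.HolderConjugate q) {x z z' : E} {C : Set E} (hC : Convex ℝ C)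
    (hz : IsBregmanProj p C x z) (hz' : IsBregmanProj p C x z') : z = z' := by
  have h1 := hM.rpow_le_bregman_sub hpq hC hz hz'.1
  have h2 := hz'.2 z hz.1
  have h3 : 0 < κ / p := div_pos hκ hpq.pos
  have h4 : ‖z - z'‖ ^ p ≤ 0 := by
    by_contra! h
    have := mul_pos h3 h
    linarith
  have h5 := le_antisymm h4 (by positivity)
  rw [Real.rpow_eq_zero (norm_nonneg _) hpq.ne_zero, norm_eq_zero] at h5
  exact sub_eq_zero.1 h5

/-- The term `‖u‖ ^ p / p` cancels, leaving a half-space (possibly degenerate). -/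
lemma setOf_bregman_le_eq (hpq : p.HolderConjugate q) (y z : E) :
    {u : E | bregman p y u ≤ bregman p z u} =
      {u : E | (J p z - J p y) u ≤ ‖J p z‖ ^ q / q - ‖J p y‖ ^ q / q} := by
  ext u
  simp only [Set.mem_ofPred_eq, sub_apply, bregman_eq hpq]
  constructor <;> intro h <;> linarith

lemma isClosed_setOf_bregman_le (hpq : p.HolderConjugate q) (y z : E) :
    IsClosed {u : E | bregman p y u ≤ bregman p z u} := by
  rw [setOf_bregman_le_eq hpq]
  exact isClosed_le (J p z - J p y).continuous continuous_const

lemma convex_setOf_bregman_le (hpq : p.HolderConjugate q) (y z : E) :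
    Convex ℝ {u : E | bregman p y u ≤ bregman p z u} := by
  rw [setOf_bregman_le_eq hpq]
  exact convex_halfSpace_le (J p z - J p y).toLinearMap.isLinear _

lemma PowerConvex.eq_of_bregman_nonpos (hM : PowerConvex E p κ) (hκ : 0 < κ)
    (hpq : p.HolderConjugate q) {x y : E} (h : bregman p x y ≤ 0) : x = y := by
  have h1 := (hM.rpow_le_bregman hpq x y).trans h
  have h3 : 0 < 2 * κ / p := div_pos (by positivity) hpq.pos
  have h4 : ‖x - y‖ ^ p ≤ 0 := by
    by_contra! h
    have := mul_pos h3 h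
    linarith
  have h5 := le_antisymm h4 (by positivity)
  rw [Real.rpow_eq_zero (norm_nonneg _) hpq.ne_zero, norm_eq_zero] at h5
  exact sub_eq_zero.1 h5

/-- Continuity of the inverse of the duality mapping. -/
lemma PowerConvex.tendsto_of_tendsto_J (hM : PowerConvex E p κ) (hκ : 0 < κ)
    (hpq : p.HolderConjugate q) {ι : Type*} {l : Filter ι} {u : ι → E} {x : E}
    (h : Tendsto (fun i => J p (u i)) l (𝓝 (J p x))) : Tendsto u l (𝓝 x) := by
  have hb : Tendsto (fun i => bregman p (u i) x) l (𝓝 0) := by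
    have h1 : Tendsto (fun i => ‖x‖ ^ p / p + ‖J p (u i)‖ ^ q / q - J p (u i) x) l
        (𝓝 (‖x‖ ^ p / p + ‖J p x‖ ^ q / q - J p x x)) := by
      refine Tendsto.sub (Tendsto.const_add _ (Tendsto.div_const ?_ _)) ?_
      · exact h.norm.rpow_const (Or.inr hpq.symm.pos.le)
      · exact ((ContinuousLinearMap.apply ℝ ℝ x).continuous.tendsto _).comp h
    rw [← bregman_eq hpq, bregman, sub_self, sub_self, map_zero, sub_zero] at h1
    exact h1.congr fun i => (bregman_eq hpq _ _).symm
  exact tendsto_of_tendsto_rpow_norm_sub (c := 2 * κ / p) hpq.pos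
    (div_pos (by positivity) hpq.pos) tendsto_const_nhds hb
    (Eventually.of_forall fun i => hM.rpow_le_bregman hpq _ _)

lemma tendsto_bregman_zero (hp : 1 < p) {ι : Type*} {l : Filter ι} {u v : ι → E} {x : E}
    (hu : Tendsto u l (𝓝 x)) (hv : Tendsto v l (𝓝 x)) :
    Tendsto (fun i => bregman p (u i) (v i)) l (𝓝 0) := by
  have hpw : ∀ {k : ι → E}, Tendsto k l (𝓝 x) →
      Tendsto (fun i => ‖k i‖ ^ p / p) l (𝓝 (‖x‖ ^ p / p)) := fun hk =>
    (hk.norm.rpow_const (Or.inr (by linarith))).div_const p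
  have hJ : Tendsto (fun i => J p (u i) (v i - u i)) l (𝓝 0) := by
    have h1 : Tendsto (fun i => ‖u i‖ ^ (p - 1) * ‖v i - u i‖) l
        (𝓝 (‖x‖ ^ (p - 1) * ‖x - x‖)) :=
      (hu.norm.rpow_const (Or.inr (by linarith))).mul (hv.sub hu).norm
    rw [sub_self, norm_zero, mul_zero] at h1
    refine squeeze_zero_norm (fun i => ?_) h1
    rw [← (J_mem hp (u i)).2]
    exact (J p (u i)).le_opNorm _
  have := ((hpw hv).sub (hpw hu)).sub hJ
  simpa [bregman] using this

end Bregman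

end InertialSplit

namespace InertialSplit

/-! ### Fixed point sets -/

section FixedPoints

variable {E : Type*} [NormedAddCommGroup E] [NormedSpace ℝ E] {p q κ : ℝ}

lemma FirmlyNonexpansiveLike.apply_sub_nonneg {S : E → E} (hS : FirmlyNonexpansiveLike p S)
    (hp : 1 < p) {v : E} (hv : v ∈ Function.fixedPoints S) (x : E) :
    0 ≤ J p (x - S x) (S x - v) := by
  have h := hS x v
  rwa [show S v = v from hv, sub_self, J_zero hp, sub_zero] at h

lemma FirmlyNonexpansiveLike.rpow_le_apply {S : E → E} (hS : FirmlyNonexpansiveLike p S)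
    (hp : 1 < p) {v : E} (hv : v ∈ Function.fixedPoints S) (x : E) :
    ‖x - S x‖ ^ p ≤ J p (x - S x) (x - v) := by
  have h := hS.apply_sub_nonneg hp hv x
  rw [← (J_mem hp (x - S x)).1, ← sub_add_sub_cancel x (S x) v, map_add]
  linarith

lemma mem_fixedPoints_of_apply_nonpos {S : E → E} (hp : 1 < p) {x : E}
    (h : J p (x - S x) (x - S x) ≤ 0) : x ∈ Function.fixedPoints S := by
  rw [(J_mem hp (x - S x)).1] at h
  have h5 := le_antisymm h (by positivity)
  rw [Real.rpow_eq_zero (norm_nonneg _) (by linarith), norm_eq_zero] at h5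
  exact (sub_eq_zero.1 h5).symm

/-- The fixed point set is an intersection of half-spaces indexed by `x`; the one with `x = v`
already forces `v` to be fixed. The same device serves `T`. -/
lemma FirmlyNonexpansiveLike.convex_fixedPoints {S : E → E} (hS : FirmlyNonexpansiveLike p S)
    (hp : 1 < p) : Convex ℝ (Function.fixedPoints S) := by
  have h : Function.fixedPoints S = ⋂ x, {v | J p (x - S x) v ≤ J p (x - S x) (S x)} := by
    ext v
    simp only [Set.mem_iInter, Set.mem_ofPred_eq]
    refine ⟨fun hv x => ?_, fun H => mem_fixedPoints_of_apply_nonpos hp ?_⟩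
    · have := hS.apply_sub_nonneg hp hv x
      rw [map_sub] at this
      linarith
    · rw [map_sub]
      linarith [H v]
  rw [h]
  exact convex_iInter fun x => convex_halfSpace_le (J p (x - S x)).toLinearMap.isLinear _

lemma LeftBregmanQuasiNonexpansive.convex_fixedPoints {T : E → E}
    (hT : LeftBregmanQuasiNonexpansive p T) (hM : PowerConvex E p κ) (hκ : 0 < κ)
    (hpq : p.HolderConjugate q) : Convex ℝ (Function.fixedPoints T) := by
  have h : Function.fixedPoints T = ⋂ x, {v | bregman p (T x) v ≤ bregman p x v} := by
    ext v
    simp only [Set.mem_iInter, Set.mem_ofPred_eq]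
    refine ⟨fun hv x => hT.2 x v hv, fun H => hM.eq_of_bregman_nonpos hκ hpq ?_⟩
    simpa [bregman] using H v
  rw [h]
  exact convex_iInter fun x => convex_setOf_bregman_le hpq _ _

/-- Passing to the limit in a firmly nonexpansive-like mapping with vanishing residual. -/
lemma FirmlyNonexpansiveLike.mem_fixedPoints_of_tendsto {S : E → E}
    (hS : FirmlyNonexpansiveLike p S) (hp : 1 < p) {ι : Type*} {l : Filter ι} [l.NeBot]
    {v : ι → E} {x : E} (hv : Tendsto v l (𝓝 x))
    (hr : Tendsto (fun i => v i - S (v i)) l (𝓝 0)) : x ∈ Function.fixedPoints S := by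
  have hSv : Tendsto (fun i => S (v i)) l (𝓝 x) := by
    simpa using hv.sub hr
  have h1 : Tendsto (fun i => (J p (v i - S (v i)) - J p (x - S x)) (S (v i) - S x)) l
      (𝓝 ((0 - J p (x - S x)) (x - S x))) :=
    (isBoundedBilinearMap_apply.continuous.tendsto (0 - J p (x - S x), x - S x)).comp
      (((tendsto_J_zero hp hr).sub_const _).prodMk_nhds (hSv.sub_const _))
  have h2 := ge_of_tendsto' h1 fun i => hS (v i) x
  refine mem_fixedPoints_of_apply_nonpos hp ?_
  rw [zero_sub, neg_apply] at h2
  linarith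

end FixedPoints

/-! ### Invariants and existence of the iteration -/

section Algorithm

variable {E₁ E₂ : Type*} [NormedAddCommGroup E₁] [NormedSpace ℝ E₁]
  [NormedAddCommGroup E₂] [NormedSpace ℝ E₂] {p q κ : ℝ}

lemma convex_solutionSet (hM : PowerConvex E₁ p κ) (hκ : 0 < κ) (hpq : p.HolderConjugate q)
    {A : E₁ →L[ℝ] E₂} {T : E₁ → E₁} {S : E₂ → E₂} (hT : LeftBregmanQuasiNonexpansive p T)
    (hS : FirmlyNonexpansiveLike p S) : Convex ℝ (solutionSet A T S) :=
  (hT.convex_fixedPoints hM hκ hpq).inter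
    ((hS.convex_fixedPoints hpq.lt).linear_preimage A.toLinearMap)

/-- The dual smoothness inequality is expanded at `J p w`. The bound on `γ` lets the linear term,
which dominates `q * γ * ‖ψ‖ ^ q` by `rpow_le_apply`, absorb the remainder. -/
lemma PowerConvex.bregman_gradient_step_le [CompleteSpace E₁] (hM : PowerConvex E₁ p κ)
    (hκ : 0 < κ) (hpq : p.HolderConjugate q) (hU : UniformlySmooth E₁)
    {A : E₁ →L[ℝ] E₂} {S : E₂ → E₂}
    (hS : FirmlyNonexpansiveLike p S) {γ : ℝ} (hγ : 0 < γ)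
    (hγ' : smoothnessConst (StrongDual ℝ E₁) q * ‖A‖ ^ q * γ ^ (q - 1) < q) {w z u : E₁}
    (hz : IsDualJ q (J p w - γ • (J p (A w - S (A w))).comp A) z)
    (hu : A u ∈ Function.fixedPoints S) : bregman p z u ≤ bregman p w u := by
  have hq := hpq.symm.pos
  have hJz := hU.J_eq hpq.lt (mem_dualityMap_of_isDualJ hpq hz)
  set ψ := J p (A w - S (A w)) with hψ
  set K := smoothnessConst (StrongDual ℝ E₁) q with hK
  have hK0 : 0 ≤ K := Real.sInf_nonneg fun C hC => hC.1
  have h1 := hM.norm_sub_rpow_le_smoothnessConst hκ hpq (J_mem hpq.lt w) (γ • ψ.comp A)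
  rw [← hJz] at h1
  have hψn : ‖ψ‖ ^ q = ‖A w - S (A w)‖ ^ p := norm_rpow_of_mem_dualityMap hpq (J_mem hpq.lt _)
  have h2 : ‖ψ‖ ^ q ≤ ψ (A w - A u) := hψn.trans_le (hS.rpow_le_apply hpq.lt hu (A w))
  have h3 : ‖γ • ψ.comp A‖ ^ q ≤ γ * γ ^ (q - 1) * ‖A‖ ^ q * ‖ψ‖ ^ q := by
    have : γ * γ ^ (q - 1) = γ ^ q := by rw [Real.rpow_sub_one hγ.ne']; field_simp
    rw [this, ← Real.mul_rpow hγ.le (norm_nonneg _),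
      ← Real.mul_rpow (by positivity) (norm_nonneg _)]
    refine Real.rpow_le_rpow (norm_nonneg _) ?_ hq.le
    rw [norm_smul, Real.norm_of_nonneg hγ.le, mul_assoc]
    gcongr
    rw [mul_comm]
    exact ψ.opNorm_comp_le A
  have h4 : K * ‖γ • ψ.comp A‖ ^ q ≤ q * (γ * ‖ψ‖ ^ q) := by
    calc K * ‖γ • ψ.comp A‖ ^ q ≤ K * (γ * γ ^ (q - 1) * ‖A‖ ^ q * ‖ψ‖ ^ q) := by gcongr
      _ = (K * ‖A‖ ^ q * γ ^ (q - 1)) * (γ * ‖ψ‖ ^ q) := by ring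
      _ ≤ q * (γ * ‖ψ‖ ^ q) := by gcongr
  have h5 : ‖J p z‖ ^ q ≤ ‖J p w‖ ^ q - q * (γ * ψ (A u)) := by
    have h6 : γ * ‖ψ‖ ^ q ≤ γ * ψ (A w - A u) := by gcongr
    have h7 := mul_le_mul_of_nonneg_left h6 hq.le
    rw [map_sub] at h7
    simp only [smul_apply, smul_eq_mul, ContinuousLinearMap.comp_apply] at h1
    linarith
  have h8 : ‖J p z‖ ^ q / q ≤ ‖J p w‖ ^ q / q - γ * ψ (A u) := by
    have := div_le_div_of_nonneg_right h5 hq.le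
    rwa [sub_div, mul_div_cancel_left₀ _ hq.ne'] at this
  rw [bregman_eq hpq, bregman_eq hpq]
  have h9 : J p z u = J p w u - γ * ψ (A u) := by
    rw [hJz]
    simp
  linarith

lemma bregman_average_le {E : Type*} [NormedAddCommGroup E] [NormedSpace ℝ E]
    (hpq : p.HolderConjugate q) (hU : UniformlySmooth E)
    {a : ℝ} (ha0 : 0 ≤ a) (ha1 : a ≤ 1) {v z y u : E}
    (hy : IsDualJ q (a • J p z + (1 - a) • J p v) y) :
    bregman p y u ≤ a * bregman p z u + (1 - a) * bregman p v u := by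
  have hq := hpq.symm.pos
  have hJy := hU.J_eq hpq.lt (mem_dualityMap_of_isDualJ hpq hy)
  have h1 : ‖J p y‖ ≤ a * ‖J p z‖ + (1 - a) * ‖J p v‖ := by
    rw [hJy]
    refine (norm_add_le _ _).trans ?_
    rw [norm_smul, norm_smul, Real.norm_of_nonneg ha0,
      Real.norm_of_nonneg (by linarith : 0 ≤ 1 - a)]
  have h2 : ‖J p y‖ ^ q ≤ a * ‖J p z‖ ^ q + (1 - a) * ‖J p v‖ ^ q :=
    (Real.rpow_le_rpow (norm_nonneg _) h1 hq.le).trans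
      ((convexOn_rpow hpq.symm.lt.le).2 (norm_nonneg _) (norm_nonneg _) ha0
        (by linarith : 0 ≤ 1 - a) (by ring))
  have h3 : J p y u = a * J p z u + (1 - a) * J p v u := by
    rw [hJy]
    simp
  have h4 := div_le_div_of_nonneg_right h2 hq.le
  have h5 : (a * ‖J p z‖ ^ q + (1 - a) * ‖J p v‖ ^ q) / q =
      a * (‖J p z‖ ^ q / q) + (1 - a) * (‖J p v‖ ^ q / q) := by ring
  rw [h5] at h4
  simp only [bregman_eq hpq]
  rw [h3]
  linarith

lemma bregman_mann_step_le {E : Type*} [NormedAddCommGroup E] [NormedSpace ℝ E]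
    (hpq : p.HolderConjugate q) (hU : UniformlySmooth E) {T : E → E}
    (hT : LeftBregmanQuasiNonexpansive p T) {a : ℝ} (ha0 : 0 ≤ a) (ha1 : a ≤ 1) {z y u : E}
    (hy : IsDualJ q (a • J p z + (1 - a) • J p (T z)) y) (hu : u ∈ Function.fixedPoints T) :
    bregman p y u ≤ bregman p z u := by
  have h1 := bregman_average_le hpq hU ha0 ha1 hy (u := u)
  have h2 := mul_le_mul_of_nonneg_left (hT.2 z u hu) (by linarith : 0 ≤ 1 - a)
  linarith

/-- The shrinking sets are closed and convex and contain the solution set. -/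
lemma PowerConvex.shrinking_sets [CompleteSpace E₁] (hM : PowerConvex E₁ p κ)
    (hκ : 0 < κ) (hpq : p.HolderConjugate q) (hU : UniformlySmooth E₁)
    {A : E₁ →L[ℝ] E₂} {T : E₁ → E₁}
    {S : E₂ → E₂} (hT : LeftBregmanQuasiNonexpansive p T) (hS : FirmlyNonexpansiveLike p S)
    {γ α : ℕ → ℝ} (hγ : ∀ n, 1 ≤ n → 0 < γ n ∧
      smoothnessConst (StrongDual ℝ E₁) q * ‖A‖ ^ q * γ n ^ (q - 1) < q)
    (hα : ∀ n, 1 ≤ n → α n ∈ Set.Icc (0 : ℝ) 1) {w z y : ℕ → E₁} {C : ℕ → Set E₁}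
    (hC1 : C 1 = Set.univ)
    (hz : ∀ n, 1 ≤ n →
      IsDualJ q (J p (w n) - γ n • (J p (A (w n) - S (A (w n)))).comp A) (z n))
    (hy : ∀ n, 1 ≤ n → IsDualJ q (α n • J p (z n) + (1 - α n) • J p (T (z n))) (y n))
    (hC : ∀ n, 1 ≤ n → C (n + 1) =
      {u ∈ C n | bregman p (y n) u ≤ bregman p (z n) u ∧ bregman p (z n) u ≤ bregman p (w n) u})
    (n : ℕ) (hn : 1 ≤ n) : IsClosed (C n) ∧ Convex ℝ (C n) ∧ solutionSet A T S ⊆ C n := by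
  induction n, hn using Nat.le_induction with
  | base =>
    rw [hC1]
    exact ⟨isClosed_univ, convex_univ, Set.subset_univ _⟩
  | succ n hn ih =>
    rw [hC n hn]
    obtain ⟨h1, h2, h3⟩ := ih
    refine ⟨?_, ?_, fun u hu => ⟨h3 hu, ?_, ?_⟩⟩
    · exact h1.inter ((isClosed_setOf_bregman_le hpq _ _).inter (isClosed_setOf_bregman_le hpq _ _))
    · exact h2.inter ((convex_setOf_bregman_le hpq _ _).inter (convex_setOf_bregman_le hpq _ _))
    · exact bregman_mann_step_le hpq hU hT (hα n hn).1 (hα n hn).2 (hy n hn) hu.1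
    · exact hM.bregman_gradient_step_le hκ hpq hU hS (hγ n hn).1 (hγ n hn).2 (hz n hn) hu.2

lemma PowerConvex.exists_isGenerated [CompleteSpace E₁] (hM : PowerConvex E₁ p κ)
    (hκ : 0 < κ) (hpq : p.HolderConjugate q) (hU : UniformlySmooth E₁)
    {A : E₁ →L[ℝ] E₂} {T : E₁ → E₁}
    {S : E₂ → E₂} (hT : LeftBregmanQuasiNonexpansive p T) (hS : FirmlyNonexpansiveLike p S)
    {γ α : ℕ → ℝ} (θ : ℕ → ℝ) (hγ : ∀ n, 1 ≤ n → 0 < γ n ∧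
      smoothnessConst (StrongDual ℝ E₁) q * ‖A‖ ^ q * γ n ^ (q - 1) < q)
    (hα : ∀ n, 1 ≤ n → α n ∈ Set.Icc (0 : ℝ) 1) (hΓ : (solutionSet A T S).Nonempty)
    (x₀ x₁ : E₁) : ∃ (x w z y : ℕ → E₁) (C : ℕ → Set E₁),
      IsGenerated p q A T S γ α θ x₀ x₁ x w z y C := by
  choose Jinv hJinv using fun φ : StrongDual ℝ E₁ => hM.exists_isDualJ hκ hpq φ
  let W (n : ℕ) (s : E₁ × E₁ × Set E₁) : E₁ := Jinv (J p s.2.1 + θ n • J p (s.2.1 - s.1))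
  let Z (n : ℕ) (s : E₁ × E₁ × Set E₁) : E₁ :=
    Jinv (J p (W n s) - γ n • (J p (A (W n s) - S (A (W n s)))).comp A)
  let Y (n : ℕ) (s : E₁ × E₁ × Set E₁) : E₁ :=
    Jinv (α n • J p (Z n s) + (1 - α n) • J p (T (Z n s)))
  let D (n : ℕ) (s : E₁ × E₁ × Set E₁) : Set E₁ :=
    {u ∈ s.2.2 | bregman p (Y n s) u ≤ bregman p (Z n s) u ∧
      bregman p (Z n s) u ≤ bregman p (W n s) u}
  -- The value is arbitrary when no projection exists. `shrinking_sets` does not use the projection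
  -- step, so it can be applied first to show that the projections do exist.
  let P (C : Set E₁) : E₁ := Classical.epsilon fun v => IsBregmanProj p C x₀ v
  -- `st k` is the triple `(x k, x (k + 1), C (k + 1))`
  let st : ℕ → E₁ × E₁ × Set E₁ := fun k => Nat.rec (x₀, x₁, Set.univ)
    (fun k s => (s.2.1, P (D (k + 1) s), D (k + 1) s)) k
  have hz : ∀ n, 1 ≤ n → IsDualJ q (J p (W n (st (n - 1))) - γ n •
      (J p (A (W n (st (n - 1))) - S (A (W n (st (n - 1)))))).comp A) (Z n (st (n - 1))) :=
    fun n _ => hJinv _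
  have hy : ∀ n, 1 ≤ n → IsDualJ q (α n • J p (Z n (st (n - 1))) +
      (1 - α n) • J p (T (Z n (st (n - 1))))) (Y n (st (n - 1))) := fun n _ => hJinv _
  have hC : ∀ n, 1 ≤ n → (st (n + 1 - 1)).2.2 = {u ∈ (st (n - 1)).2.2 |
      bregman p (Y n (st (n - 1))) u ≤ bregman p (Z n (st (n - 1))) u ∧
      bregman p (Z n (st (n - 1))) u ≤ bregman p (W n (st (n - 1))) u} := by
    intro n hn
    obtain ⟨k, rfl⟩ := Nat.exists_eq_add_of_le' hn
    rfl
  have hsets := hM.shrinking_sets hκ hpq hU hT hS hγ hα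
    (C := fun n => (st (n - 1)).2.2) rfl hz hy hC
  refine ⟨fun n => (st n).1, fun n => W n (st (n - 1)), fun n => Z n (st (n - 1)),
    fun n => Y n (st (n - 1)), fun n => (st (n - 1)).2.2,
    ⟨rfl, rfl, rfl, fun n hn => ?_, hz, hy, hC, fun n hn => ?_⟩⟩
  · obtain ⟨k, rfl⟩ := Nat.exists_eq_add_of_le' hn
    exact hJinv _
  · obtain ⟨h1, h2, h3⟩ := hsets (n + 1) (by omega)
    obtain ⟨k, rfl⟩ := Nat.exists_eq_add_of_le' hn
    exact Classical.epsilon_spec (hM.exists_isBregmanProj hκ hpq x₀ h1 h2 (hΓ.mono h3))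

/-! ### Convergence and identification of the limit -/

section Convergence

variable {A : E₁ →L[ℝ] E₂} {T : E₁ → E₁} {S : E₂ → E₂} {γ α θ : ℕ → ℝ} {x₀ x₁ : E₁}
  {x w z y : ℕ → E₁} {C : ℕ → Set E₁}

lemma IsGenerated.antitone (h : IsGenerated p q A T S γ α θ x₀ x₁ x w z y C) {m n : ℕ}
    (hm : 1 ≤ m) (hmn : m ≤ n) : C n ⊆ C m := by
  induction n, hmn using Nat.le_induction with
  | base => exact subset_rfl
  | succ n hn ih =>
    rw [h.C_step n (hm.trans hn)]
    exact (Set.sep_subset _ _).trans ih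

lemma IsGenerated.exists_tendsto [CompleteSpace E₁]
    (h : IsGenerated p q A T S γ α θ x₀ x₁ x w z y C)
    (hM : PowerConvex E₁ p κ) (hκ : 0 < κ) (hpq : p.HolderConjugate q)
    (hCc : ∀ n, 1 ≤ n → Convex ℝ (C n)) {u : E₁} (hu : ∀ n, 1 ≤ n → u ∈ C n) :
    ∃ v, Tendsto x atTop (𝓝 v) := by
  -- The shift by two skips the free initial values: `x 2` is the first projection.
  have hmono : Monotone fun n => bregman p x₀ (x (n + 2)) := monotone_nat_of_le_succ fun n =>
    (h.x_step (n + 1) (by omega)).2 _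
      (h.antitone (by omega) (Nat.le_succ _) (h.x_step (n + 2) (by omega)).1)
  have hbdd : BddAbove (Set.range fun n => bregman p x₀ (x (n + 2))) := by
    refine ⟨bregman p x₀ u, ?_⟩
    rintro _ ⟨n, rfl⟩
    exact (h.x_step (n + 1) (by omega)).2 _ (hu _ (by omega))
  have hlim := tendsto_atTop_ciSup hmono hbdd
  set M := ⨆ n, bregman p x₀ (x (n + 2))
  have hle : ∀ n, bregman p x₀ (x (n + 2)) ≤ M := fun n => le_ciSup hbdd n
  have hkey : ∀ N m n, N ≤ m → m ≤ n → ‖x (m + 2) - x (n + 2)‖ ^ p ≤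
      p / κ * ((M - bregman p x₀ (x (N + 2))) / 2) := by
    intro N m n hN hmn
    have h1 := hM.rpow_le_bregman_sub hpq (hCc (m + 2) (by omega)) (h.x_step (m + 1) (by omega))
      (h.antitone (by omega) (by omega) (h.x_step (n + 1) (by omega)).1)
    have h2 := hle n
    have h3 : bregman p x₀ (x (N + 2)) ≤ bregman p x₀ (x (m + 2)) := hmono hN
    have hp := hpq.pos
    calc ‖x (m + 2) - x (n + 2)‖ ^ p = p / κ * (κ / p * ‖x (m + 2) - x (n + 2)‖ ^ p) := by
          field_simp
      _ ≤ _ := by gcongr; linarith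
  have hcs : CauchySeq fun n => x (n + 2) := by
    refine cauchySeq_of_norm_sub_rpow_le hpq.pos
      (b := fun N => p / κ * ((M - bregman p x₀ (x (N + 2))) / 2)) (fun N m n hm hn => ?_) ?_
    · rcases le_total m n with hmn | hmn
      · exact hkey N m n hm hmn
      · rw [norm_sub_rev]
        exact hkey N n m hn hmn
    · simpa using ((hlim.const_sub M).div_const 2).const_mul (p / κ)
  obtain ⟨v, hv⟩ := cauchySeq_tendsto_of_complete hcs
  exact ⟨v, (tendsto_add_atTop_iff_nat 2).1 hv⟩

lemma IsGenerated.tendsto_w (h : IsGenerated p q A T S γ α θ x₀ x₁ x w z y C)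
    (hM : PowerConvex E₁ p κ) (hκ : 0 < κ) (hpq : p.HolderConjugate q) (hU : UniformlySmooth E₁)
    {c d : ℝ} (hθ : ∀ n, 1 ≤ n → θ n ∈ Set.Icc c d) {v : E₁} (hx : Tendsto x atTop (𝓝 v)) :
    Tendsto w atTop (𝓝 v) := by
  refine hM.tendsto_of_tendsto_J hκ hpq ?_
  have hdiff : Tendsto (fun n => x n - x (n - 1)) atTop (𝓝 0) := by
    simpa using hx.sub (hx.comp (tendsto_sub_atTop_nat 1))
  have hθb : IsBoundedUnder (· ≤ ·) atTop fun n => ‖θ n‖ := by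
    refine isBoundedUnder_of_eventually_le (a := max |c| |d|) ?_
    filter_upwards [eventually_ge_atTop 1] with n hn
    exact abs_le_max_abs_abs (hθ n hn).1 (hθ n hn).2
  have h1 : Tendsto (fun n => θ n • J p (x n - x (n - 1))) atTop (𝓝 0) :=
    hθb.smul_tendsto_zero (tendsto_J_zero hpq.lt hdiff)
  have h2 := (((hU.continuous_J hpq.lt).tendsto v).comp hx).add h1
  rw [add_zero] at h2
  refine h2.congr' ?_
  filter_upwards [eventually_ge_atTop 1] with n hn
  exact (hU.J_eq hpq.lt (mem_dualityMap_of_isDualJ hpq (h.w_step n hn))).symm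

/-- Since `x (n + 1)` lies in `C (n + 1)`, its distance from `z n` is at most that from `w n`, which
vanishes because `x` and `w` share a limit. -/
lemma IsGenerated.tendsto_z (h : IsGenerated p q A T S γ α θ x₀ x₁ x w z y C)
    (hM : PowerConvex E₁ p κ) (hκ : 0 < κ) (hpq : p.HolderConjugate q)
    {v : E₁} (hx : Tendsto x atTop (𝓝 v)) (hw : Tendsto w atTop (𝓝 v)) :
    Tendsto z atTop (𝓝 v) := by
  have hx1 : Tendsto (fun n => x (n + 1)) atTop (𝓝 v) := hx.comp (tendsto_add_atTop_nat 1)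
  refine tendsto_of_tendsto_rpow_norm_sub (c := 2 * κ / p) hpq.pos
    (div_pos (by positivity) hpq.pos) hx1 (tendsto_bregman_zero hpq.lt hw hx1) ?_
  filter_upwards [eventually_ge_atTop 1] with n hn
  have hmem := (h.x_step n hn).1
  rw [h.C_step n hn] at hmem
  exact (hM.rpow_le_bregman hpq _ _).trans hmem.2.2

lemma IsGenerated.tendsto_y (h : IsGenerated p q A T S γ α θ x₀ x₁ x w z y C)
    (hM : PowerConvex E₁ p κ) (hκ : 0 < κ) (hpq : p.HolderConjugate q)
    {v : E₁} (hx : Tendsto x atTop (𝓝 v)) (hz : Tendsto z atTop (𝓝 v)) :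
    Tendsto y atTop (𝓝 v) := by
  have hx1 : Tendsto (fun n => x (n + 1)) atTop (𝓝 v) := hx.comp (tendsto_add_atTop_nat 1)
  refine tendsto_of_tendsto_rpow_norm_sub (c := 2 * κ / p) hpq.pos
    (div_pos (by positivity) hpq.pos) hx1 (tendsto_bregman_zero hpq.lt hz hx1) ?_
  filter_upwards [eventually_ge_atTop 1] with n hn
  have hmem := (h.x_step n hn).1
  rw [h.C_step n hn] at hmem
  exact (hM.rpow_le_bregman hpq _ _).trans hmem.2.1

/-- Dividing `J p (y n) - J p (z n)` by `1 - α n`, bounded away from zero, shows that `J p (T (z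
n))` tends to `J p v`; hence `T (z n)` tends to `v` and closedness applies. -/
lemma IsGenerated.limit_mem_fixedPoints (h : IsGenerated p q A T S γ α θ x₀ x₁ x w z y C)
    (hM : PowerConvex E₁ p κ) (hκ : 0 < κ) (hpq : p.HolderConjugate q) (hU : UniformlySmooth E₁)
    (hTc : ClosedMapping T) {b : ℝ} (hb : b < 1) (hα : ∀ n, 1 ≤ n → α n ≤ b)
    {v : E₁} (hz : Tendsto z atTop (𝓝 v)) (hy : Tendsto y atTop (𝓝 v)) :
    v ∈ Function.fixedPoints T := by
  have hJ := hU.continuous_J hpq.lt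
  have hJz := (hJ.tendsto v).comp hz
  have h1 := ((hJ.tendsto v).comp hy).sub hJz
  rw [sub_self] at h1
  have hbd : IsBoundedUnder (· ≤ ·) atTop fun n => ‖(1 - α n)⁻¹‖ := by
    refine isBoundedUnder_of_eventually_le (a := (1 - b)⁻¹) ?_
    filter_upwards [eventually_ge_atTop 1] with n hn
    have := hα n hn
    rw [norm_inv, Real.norm_of_nonneg (by linarith)]
    exact inv_anti₀ (by linarith) (by linarith)
  have h2 := (hbd.smul_tendsto_zero h1).add hJz
  rw [zero_add] at h2
  refine hTc z v v hz (hM.tendsto_of_tendsto_J hκ hpq (h2.congr' ?_))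
  filter_upwards [eventually_ge_atTop 1] with n hn
  have hne : 1 - α n ≠ 0 := by
    have := hα n hn
    linarith
  have hJy := hU.J_eq hpq.lt (mem_dualityMap_of_isDualJ hpq (h.y_step n hn))
  have h3 : J p (y n) - J p (z n) = (1 - α n) • (J p (T (z n)) - J p (z n)) := by
    rw [hJy]
    module
  simp only [Function.comp_apply]
  rw [h3, inv_smul_smul₀ hne, sub_add_cancel]

lemma IsGenerated.apply_limit_mem_fixedPoints
    (h : IsGenerated p q A T S γ α θ x₀ x₁ x w z y C) (hpq : p.HolderConjugate q)
    (hU : UniformlySmooth E₁) (hS : FirmlyNonexpansiveLike p S) (hγ : ∀ n, 1 ≤ n → 0 < γ n)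
    (hγ' : ¬ Tendsto γ atTop (𝓝 0)) {u : E₁} (hu : A u ∈ Function.fixedPoints S)
    {v : E₁} (hw : Tendsto w atTop (𝓝 v)) (hz : Tendsto z atTop (𝓝 v)) :
    A v ∈ Function.fixedPoints S := by
  obtain ⟨ε, hε, hfr⟩ : ∃ ε : ℝ, 0 < ε ∧ ∃ᶠ n in atTop, ε ≤ γ n := by
    by_contra! H
    refine hγ' (Metric.tendsto_nhds.2 fun ε hε => ?_)
    filter_upwards [H ε hε, eventually_ge_atTop 1] with n h1 h2
    rw [Real.dist_eq, sub_zero, abs_of_pos (hγ n h2)]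
    exact h1
  -- Only the indices with `ε ≤ γ n` allow division by `γ n`. This subsequence is enough, since `w`
  -- and `z` converge along the whole of `atTop`.
  set l : Filter ℕ := atTop ⊓ 𝓟 {n | ε ≤ γ n} with hl
  have hlne : l.NeBot := frequently_mem_iff_neBot.1 hfr
  have hlle : l ≤ atTop := inf_le_left
  have hJ := hU.continuous_J hpq.lt
  set ψ : ℕ → StrongDual ℝ E₁ := fun n => (J p (A (w n) - S (A (w n)))).comp A with hψ
  have h1 := (((hJ.tendsto v).comp hw).sub ((hJ.tendsto v).comp hz)).mono_left hlle
  rw [sub_self] at h1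
  have hbd : IsBoundedUnder (· ≤ ·) l fun n => ‖(γ n)⁻¹‖ := by
    refine isBoundedUnder_of_eventually_le (a := ε⁻¹) ?_
    filter_upwards [mem_inf_of_right (mem_principal_self _)] with n hn
    have hn : ε ≤ γ n := hn
    rw [norm_inv, Real.norm_of_nonneg (by linarith)]
    exact inv_anti₀ hε hn
  have h2 : Tendsto ψ l (𝓝 0) := by
    refine (hbd.smul_tendsto_zero h1).congr' ?_
    filter_upwards [hlle (eventually_ge_atTop 1)] with n hn
    have hJz := hU.J_eq hpq.lt (mem_dualityMap_of_isDualJ hpq (h.z_step n hn))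
    simp only [Function.comp_apply]
    rw [hJz, sub_sub_cancel, inv_smul_smul₀ (hγ n hn).ne']
  have hwl := hw.mono_left hlle
  have h3 : Tendsto (fun n => ψ n (w n - u)) l (𝓝 0) := by
    simpa [Function.comp_def] using (isBoundedBilinearMap_apply.continuous.tendsto (0, v - u)).comp
      (h2.prodMk_nhds (hwl.sub_const u))
  -- Because `A u` is fixed by `S`, the residual to the power `p` is at most `ψ n (w n - u)`.
  have hres : Tendsto (fun n => A (w n) - S (A (w n))) l (𝓝 0) := by
    refine tendsto_of_tendsto_rpow_norm_sub (v := fun _ => 0) (c := 1) hpq.pos one_pos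
      tendsto_const_nhds h3 (Eventually.of_forall fun n => ?_)
    have := hS.rpow_le_apply hpq.lt hu (A (w n))
    rw [sub_zero, one_mul]
    simpa [hψ] using this
  exact hS.mem_fixedPoints_of_tendsto hpq.lt ((A.continuous.tendsto v).comp hwl) hres

lemma IsGenerated.isBregmanProj_limit (h : IsGenerated p q A T S γ α θ x₀ x₁ x w z y C)
    (hpq : p.HolderConjugate q) (hΓ : ∀ n, 1 ≤ n → solutionSet A T S ⊆ C n) {v : E₁}
    (hx : Tendsto x atTop (𝓝 v)) (hv : v ∈ solutionSet A T S) :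
    IsBregmanProj p (solutionSet A T S) x₀ v := by
  refine ⟨hv, fun u hu => ?_⟩
  have hc : Continuous fun v => bregman p x₀ v := by
    have : Continuous fun y : E₁ => ‖y‖ ^ p :=
      continuous_norm.rpow_const fun _ => Or.inr hpq.pos.le
    unfold bregman
    fun_prop
  refine le_of_tendsto ((hc.tendsto v).comp (hx.comp (tendsto_add_atTop_nat 1))) ?_
  filter_upwards [eventually_ge_atTop 1] with n hn
  exact (h.x_step n hn).2 u (hΓ _ (by omega) hu)

end Convergence

end Algorithm

end InertialSplit

open InertialSplit in
theorem theorem3p2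
    {E₁ E₂ : Type*}
    [NormedAddCommGroup E₁] [NormedSpace ℝ E₁] [CompleteSpace E₁]
    [NormedAddCommGroup E₂] [NormedSpace ℝ E₂] [CompleteSpace E₂]
    (p q : ℝ) (hp : 2 ≤ p) (hpq : 1 / p + 1 / q = 1)
    (hE₁ : PUniformlyConvex E₁ p) (hE₁' : UniformlySmooth E₁)
    (hE₂ : PUniformlyConvex E₂ p) (hE₂' : UniformlySmooth E₂)
    (A : E₁ →L[ℝ] E₂)
    (T : E₁ → E₁) (hTc : ClosedMapping T) (hT : LeftBregmanQuasiNonexpansive p T)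
    (S : E₂ → E₂) (hS : FirmlyNonexpansiveLike p S)
    (γ α θ : ℕ → ℝ)
    -- `0 < γ n < (q / (C_q ‖A‖ ^ q)) ^ (1 / (q - 1))`, the bound being `∞` when `A = 0`
    (hγ : ∀ n, 1 ≤ n → 0 < γ n ∧
      smoothnessConst (StrongDual ℝ E₁) q * ‖A‖ ^ q * γ n ^ (q - 1) < q)
    -- the step sizes do not vanish in the limit
    (hγ' : ¬ Tendsto γ atTop (𝓝 0))
    (a b : ℝ) (ha : 0 < a) (hb : b < 1) (hα : ∀ n, 1 ≤ n → α n ∈ Set.Icc a b)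
    (c d : ℝ) (hθ : ∀ n, 1 ≤ n → θ n ∈ Set.Icc c d)
    (hΓ : (solutionSet A T S).Nonempty)
    (x₀ x₁ : E₁) :
    (∃! z : E₁, IsBregmanProj p (solutionSet A T S) x₀ z) ∧
    (∃ (x w z y : ℕ → E₁) (C : ℕ → Set E₁),
      IsGenerated p q A T S γ α θ x₀ x₁ x w z y C) ∧
    (∀ (x w z y : ℕ → E₁) (C : ℕ → Set E₁),
      IsGenerated p q A T S γ α θ x₀ x₁ x w z y C →
      ∀ zΓ : E₁, IsBregmanProj p (solutionSet A T S) x₀ zΓ → Tendsto x atTop (𝓝 zΓ)) := by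
  have hpq' : p.HolderConjugate q := by
    have hp0 : 0 < p := by linarith
    have hp1 : 1 / p ≤ 1 / 2 := one_div_le_one_div_of_le two_pos hp
    refine (Real.holderConjugate_iff).2 ⟨by linarith, ?_⟩
    simpa using hpq
  obtain ⟨κ, hκ, hM⟩ := hE₁.exists_powerConvex hp
  have hα' : ∀ n, 1 ≤ n → α n ∈ Set.Icc (0 : ℝ) 1 := fun n hn =>
    ⟨ha.le.trans (hα n hn).1, (hα n hn).2.trans hb.le⟩
  have hconv := convex_solutionSet (A := A) hM hκ hpq' hT hS
  obtain ⟨u, hu⟩ := hΓ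
  have hmain : ∀ (x w z y : ℕ → E₁) (C : ℕ → Set E₁),
      IsGenerated p q A T S γ α θ x₀ x₁ x w z y C →
      ∃ v, Tendsto x atTop (𝓝 v) ∧ IsBregmanProj p (solutionSet A T S) x₀ v := by
    intro x w z y C h
    have hsets := hM.shrinking_sets hκ hpq' hE₁' hT hS hγ hα' h.C_one h.z_step h.y_step h.C_step
    obtain ⟨v, hx⟩ := h.exists_tendsto hM hκ hpq' (fun n hn => (hsets n hn).2.1)
      (fun n hn => (hsets n hn).2.2 hu)
    have hw := h.tendsto_w hM hκ hpq' hE₁' hθ hx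
    have hz := h.tendsto_z hM hκ hpq' hx hw
    have hy := h.tendsto_y hM hκ hpq' hx hz
    exact ⟨v, hx, h.isBregmanProj_limit hpq' (fun n hn => (hsets n hn).2.2) hx
      ⟨h.limit_mem_fixedPoints hM hκ hpq' hE₁' hTc hb (fun n hn => (hα n hn).2) hz hy,
        h.apply_limit_mem_fixedPoints hpq' hE₁' hS (fun n hn => (hγ n hn).1) hγ' hu.2 hw hz⟩⟩
  have hex := hM.exists_isGenerated hκ hpq' hE₁' hT hS θ hγ hα' ⟨u, hu⟩ x₀ x₁
  refine ⟨?_, hex, fun x w z y C h zΓ hzΓ => ?_⟩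
  -- The projection onto the solution set is obtained as the limit of an actual run, so only
  -- convexity of that set is needed, for uniqueness.
  · obtain ⟨x, w, z, y, C, h⟩ := hex
    obtain ⟨v, -, hv⟩ := hmain x w z y C h
    exact ⟨v, hv, fun v' hv' => hM.isBregmanProj_unique hκ hpq' hconv hv' hv⟩
  · obtain ⟨v, hx, hv⟩ := hmain x w z y C h
    rwa [hM.isBregmanProj_unique hκ hpq' hconv hzΓ hv]
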